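/- **Setting.** Let $M$ be a connected smooth manifold of dimension $n>2$ with an almost contact metric structure $(\phi,\xi,\eta,g)$, that is, a smooth $(1,1)$-tensor field $\phi$, vector field $\xi$, 1-form $\eta$ and Riemannian metric $g$ with $$\phi^2=-I+\eta\otimes\xi,\quad \eta(\xi)=1,\quad \eta\circ\phi=0,\quad \phi\xi=0,$$ $$g(\phi X,\phi Y)=g(X,Y)-\eta(X)\eta(Y),\quad g(X,\phi Y)=-g(\phi X,Y),\quad g(X,\xi)=\eta(X).$$ Put $\Phi(X,Y)=g(\phi X,Y)$. For $\alpha\in\mathbb R$ the structure is *$\alpha$-cosymplectic* if $d\eta=0$, $d\Phi=2\alpha\,\eta\wedge\Phi$ and it is normal, i.e. $[\phi X,\phi Y]-\phi[\phi X,Y]-\phi[X,\phi Y]+\phi^2[X,Y]+2d\eta(X,Y)\xi=0$. It is *cosymplectic* if it is normal with $d\eta=0$ and $d\Phi=0$. For a linear connection with curvature $R(X,Y)Z=\nabla_X\nabla_YZ-\nabla_Y\nabla_XZ-\nabla_{[X,Y]}Z$, its Ricci tensor is $S(Y,Z)=\operatorname{tr}(X\mapsto R(X,Y)Z)$ and its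 scalar curvature is $r=\operatorname{tr}_gS$. Let $\nabla$ be the Levi-Civita connection, with $R,S,r$, and let $S^\ast(X,Y)=\tfrac12\operatorname{tr}\big(Z\mapsto R(X,\phi Y)\phi Z\big)$ be the $\ast$-Ricci tensor and $r^\ast=\operatorname{tr}_gS^\ast$. Let $\tilde\nabla$ be the quarter-symmetric metric connection: the connection with $\tilde\nabla g=0$ and torsion $T(X,Y)=\eta(Y)\phi X-\eta(X)\phi Y$. Let $\tilde S,\tilde r$ be its Ricci tensor and scalar curvature, and $(\tilde{\pounds}_\xi g)(Y,Z)=g(\tilde\nabla_Y\xi,Z)+g(Y,\tilde\nabla_Z\xi)$. Let $\rho,q,\Lambda,\mu$ be real constants. The metric admits a *$\ast$-$\eta$-Ricci-Yamabe soliton with constants $(\rho,q,\Lambda,\mu)$ with respect to $\nabla$* if $$\pounds_\xi g+2\rho S^\ast+[2\Lambda-qr^\ast]g+2\mu\,\eta\otimes\eta=0 .$$ If the structure is $\alpha$-cosymplectic, the metric admits one *with respect to $\tilde\nabla$* if $$\tilde{\pounds}_\xi g+2\rho\tilde S+\big[2\Lambda+2\alpha^2\rho(n-2)-q\tilde r-q\alpha^2(n-1)^2\big]g+\big[2\mu+2\alpha^2\rho\big]\eta\otimes\eta=0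 ,$$ that is, if the first equation holds with $\pounds_\xi g$ replaced by $\tilde{\pounds}_\xi g$, $S^\ast$ by $\tilde S+\alpha^2(n-2)g+\alpha^2\eta\otimes\eta$, and $r^\ast$ by the trace $\tilde r+\alpha^2(n-1)^2$ of the latter. **Corollary 4.2.** Suppose that $(\phi,\xi,\eta,g)$ is $\alpha$-cosymplectic and that $g$ admits a $\ast$-$\eta$-Ricci-Yamabe soliton with constants $(\rho,q,\Lambda,\mu)$, $\rho\neq0$, with respect to $\nabla$. Then the following are equivalent: 1. $g$ admits a $\ast$-$\eta$-Ricci-Yamabe soliton with the same constants with respect to $\tilde\nabla$; 2. $g$ admits a $\ast$-$\eta$-Ricci-Yamabe soliton with some constants $(\rho',q',\Lambda',\mu')$, $\rho'\neq0$, with respect to $\tilde\nabla$; 3. $M$ is cosymplectic; 4. $\alpha=0$. -/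

import Mathlib

open Bundle Manifold
open scoped ContDiff

noncomputable section

namespace StarRicciYamabe

variable {E : Type*} [NormedAddCommGroup E] [NormedSpace ℝ E] [FiniteDimensional ℝ E]
  {M : Type*} [TopologicalSpace M] [ChartedSpace E M] [IsManifold 𝓘(ℝ, E) ∞ M]

/-- Tangent spaces of a manifold modelled on `E` are finite-dimensional. -/
instance finiteDimensional_tangentSpace (x : M) :
    FiniteDimensional ℝ (TangentSpace 𝓘(ℝ, E) x) :=
  inferInstanceAs (FiniteDimensional ℝ E)

/-! ### Connections and curvature -/

/-- The curvature `R(X, Y) Z = ∇_X ∇_Y Z - ∇_Y ∇_X Z - ∇_{[X, Y]} Z` of a linear connection,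
on vector fields. Recall that Mathlib writes `cov Z x (X x)` for `(∇_X Z)(x)`. -/
def curvatureField (cov : CovariantDerivative 𝓘(ℝ, E) E (TangentSpace 𝓘(ℝ, E) : M → Type _))
    (X Y Z : Π x : M, TangentSpace 𝓘(ℝ, E) x) (x : M) : TangentSpace 𝓘(ℝ, E) x :=
  cov (fun y ↦ cov Z y (Y y)) x (X x) - cov (fun y ↦ cov Z y (X y)) x (Y x)
    - cov Z x (VectorField.mlieBracket 𝓘(ℝ, E) X Y x)

/-- The curvature tensor `R(u, v) w` of a smooth connection at a point `x`: the vector fields are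
Mathlib's extensions of the tangent vectors `u, v, w`, which are smooth near `x`; by tensoriality
any other extension gives the same value. -/
def curvature (cov : CovariantDerivative 𝓘(ℝ, E) E (TangentSpace 𝓘(ℝ, E) : M → Type _))
    (x : M) (u v w : TangentSpace 𝓘(ℝ, E) x) : TangentSpace 𝓘(ℝ, E) x :=
  curvatureField cov (FiberBundle.extend E u) (FiberBundle.extend E v) (FiberBundle.extend E w) x

section Riemannian

variable [RiemannianBundle (fun x : M ↦ TangentSpace 𝓘(ℝ, E) x)]

/-- An orthonormal basis of the tangent space at `x`, used for taking traces. -/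
def frame (x : M) :
    OrthonormalBasis (Fin (Module.finrank ℝ (TangentSpace 𝓘(ℝ, E) x))) ℝ
      (TangentSpace 𝓘(ℝ, E) x) :=
  stdOrthonormalBasis ℝ (TangentSpace 𝓘(ℝ, E) x)

/-- The metric trace `∑ B(eᵢ, eᵢ)` of a function of two tangent vectors at `x` (to be used for
bilinear `B`). -/
def metricTrace (x : M) (B : TangentSpace 𝓘(ℝ, E) x → TangentSpace 𝓘(ℝ, E) x → ℝ) : ℝ :=
  ∑ i, B (frame x i) (frame x i)

/-- The Ricci tensor `S(v, w)`, the trace of `u ↦ R(u, v) w`. -/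
def ricci (cov : CovariantDerivative 𝓘(ℝ, E) E (TangentSpace 𝓘(ℝ, E) : M → Type _))
    (x : M) (v w : TangentSpace 𝓘(ℝ, E) x) : ℝ :=
  metricTrace x fun u u' ↦ inner ℝ (curvature cov x u v w) u'

/-- The scalar curvature `r`, the trace of the Ricci tensor. -/
def scalarCurvature (cov : CovariantDerivative 𝓘(ℝ, E) E (TangentSpace 𝓘(ℝ, E) : M → Type _))
    (x : M) : ℝ :=
  metricTrace x (ricci cov x)

/-- The Lie derivative of the metric along `V`,
`(£_V g)(X, Y) = V g(X, Y) - g([V, X], Y) - g(X, [V, Y])`. -/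
def lieDerivMetric (V X Y : Π x : M, TangentSpace 𝓘(ℝ, E) x) (x : M) : ℝ :=
  mvfderiv 𝓘(ℝ, E) (fun y ↦ (inner ℝ (X y) (Y y) : ℝ)) x (V x)
    - inner ℝ (VectorField.mlieBracket 𝓘(ℝ, E) V X x) (Y x)
    - inner ℝ (X x) (VectorField.mlieBracket 𝓘(ℝ, E) V Y x)

/-- The Lie derivative of the metric along `V` with respect to a connection `∇`,
`g(∇_u V, v) + g(u, ∇_v V)`. -/
def lieDerivMetricWrt (cov : CovariantDerivative 𝓘(ℝ, E) E (TangentSpace 𝓘(ℝ, E) : M → Type _))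
    (V : Π x : M, TangentSpace 𝓘(ℝ, E) x) (x : M) (u v : TangentSpace 𝓘(ℝ, E) x) : ℝ :=
  inner ℝ (cov V x u) v + inner ℝ u (cov V x v)

/-- `∇` is the Levi-Civita connection: smooth, metric and torsion-free. -/
structure IsLeviCivita [IsContMDiffRiemannianBundle 𝓘(ℝ, E) ∞ E
      (fun x : M ↦ TangentSpace 𝓘(ℝ, E) x)]
    (cov : CovariantDerivative 𝓘(ℝ, E) E (TangentSpace 𝓘(ℝ, E) : M → Type _)) : Prop where
  smooth : CovariantDerivative.ContMDiffCovariantDerivative cov ∞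
  metric : CovariantDerivative.IsMetricCompatible (V := fun x : M ↦ TangentSpace 𝓘(ℝ, E) x) cov
  torsion_free : cov.torsion = 0

variable (E M) in
/-- An almost contact metric structure `(φ, ξ, η)` on the Riemannian manifold `M`. -/
structure AlmostContactMetric where
  /-- the `(1,1)` tensor field `φ` -/
  φ : Π x : M, TangentSpace 𝓘(ℝ, E) x →L[ℝ] TangentSpace 𝓘(ℝ, E) x
  /-- the vector field `ξ` -/
  ξ : Π x : M, TangentSpace 𝓘(ℝ, E) x
  /-- the 1-form `η` -/
  η : Π x : M, TangentSpace 𝓘(ℝ, E) x →L[ℝ] ℝ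
  smooth_φ : ContMDiff 𝓘(ℝ, E) (𝓘(ℝ, E).prod 𝓘(ℝ, E →L[ℝ] E)) ∞ fun x ↦
    (⟨x, φ x⟩ : TotalSpace (E →L[ℝ] E)
      fun x : M ↦ TangentSpace 𝓘(ℝ, E) x →L[ℝ] TangentSpace 𝓘(ℝ, E) x)
  smooth_ξ : ContMDiff 𝓘(ℝ, E) (𝓘(ℝ, E).prod 𝓘(ℝ, E)) ∞ fun x ↦
    (⟨x, ξ x⟩ : TotalSpace E (TangentSpace 𝓘(ℝ, E) : M → Type _))
  smooth_η : ContMDiff 𝓘(ℝ, E) (𝓘(ℝ, E).prod 𝓘(ℝ, E →L[ℝ] ℝ)) ∞ fun x ↦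
    (⟨x, η x⟩ : TotalSpace (E →L[ℝ] ℝ) fun x : M ↦ TangentSpace 𝓘(ℝ, E) x →L[ℝ] ℝ)
  φ_φ : ∀ x v, φ x (φ x v) = -v + η x v • ξ x
  η_ξ : ∀ x, η x (ξ x) = 1
  η_φ : ∀ x v, η x (φ x v) = 0
  φ_ξ : ∀ x, φ x (ξ x) = 0
  inner_φ_φ : ∀ x u v, (inner ℝ (φ x u) (φ x v) : ℝ) = inner ℝ u v - η x u * η x v
  inner_φ_right : ∀ x u v, (inner ℝ u (φ x v) : ℝ) = -inner ℝ (φ x u) v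
  inner_ξ : ∀ x v, (inner ℝ v (ξ x) : ℝ) = η x v

namespace AlmostContactMetric

variable (A : AlmostContactMetric E M)

/-- The fundamental 2-form `Φ(u, v) = g(φ u, v)`. -/
def Φ (x : M) (u v : TangentSpace 𝓘(ℝ, E) x) : ℝ := inner ℝ (A.φ x u) v

/-- `2 dη(X, Y) = X η(Y) - Y η(X) - η([X, Y])` (with the convention in which `dη` carries a factor
`1/2`; in the other convention this is `dη` itself). -/
def dη (X Y : Π x : M, TangentSpace 𝓘(ℝ, E) x) (x : M) : ℝ :=
  mvfderiv 𝓘(ℝ, E) (fun y ↦ A.η y (Y y)) x (X x) - mvfderiv 𝓘(ℝ, E) (fun y ↦ A.η y (X y)) x (Y x)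
    - A.η x (VectorField.mlieBracket 𝓘(ℝ, E) X Y x)

/-- The exterior derivative of `Φ`. The normalization is the one of `wedge`: in the convention in
which both carry a factor `1/3`, these are `3 dΦ` and `3 η ∧ Φ`. -/
def dΦ (X Y Z : Π x : M, TangentSpace 𝓘(ℝ, E) x) (x : M) : ℝ :=
  mvfderiv 𝓘(ℝ, E) (fun y ↦ A.Φ y (Y y) (Z y)) x (X x)
    + mvfderiv 𝓘(ℝ, E) (fun y ↦ A.Φ y (Z y) (X y)) x (Y x)
    + mvfderiv 𝓘(ℝ, E) (fun y ↦ A.Φ y (X y) (Y y)) x (Z x)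
    - A.Φ x (VectorField.mlieBracket 𝓘(ℝ, E) X Y x) (Z x)
    - A.Φ x (VectorField.mlieBracket 𝓘(ℝ, E) Y Z x) (X x)
    - A.Φ x (VectorField.mlieBracket 𝓘(ℝ, E) Z X x) (Y x)

/-- The wedge product `η ∧ Φ` at a point. -/
def wedge (x : M) (u v w : TangentSpace 𝓘(ℝ, E) x) : ℝ :=
  A.η x u * A.Φ x v w + A.η x v * A.Φ x w u + A.η x w * A.Φ x u v

/-- The tensor `[φX, φY] - φ[φX, Y] - φ[X, φY] + φ²[X, Y] + 2dη(X, Y) ξ`. -/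
def nijenhuis (X Y : Π x : M, TangentSpace 𝓘(ℝ, E) x) (x : M) : TangentSpace 𝓘(ℝ, E) x :=
  VectorField.mlieBracket 𝓘(ℝ, E) (fun y ↦ A.φ y (X y)) (fun y ↦ A.φ y (Y y)) x
    - A.φ x (VectorField.mlieBracket 𝓘(ℝ, E) (fun y ↦ A.φ y (X y)) Y x)
    - A.φ x (VectorField.mlieBracket 𝓘(ℝ, E) X (fun y ↦ A.φ y (Y y)) x)
    + A.φ x (A.φ x (VectorField.mlieBracket 𝓘(ℝ, E) X Y x))
    + A.dη X Y x • A.ξ x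

/-- Normality: the tensor above vanishes. As it is a tensor, it does not matter that the fields are
only required to be differentiable at the point under consideration. -/
def IsNormal : Prop :=
  ∀ (x : M) (X Y : Π x : M, TangentSpace 𝓘(ℝ, E) x),
    MDiffAt (T% X) x → MDiffAt (T% Y) x → A.nijenhuis X Y x = 0

/-- `dη = 0`. -/
def IsClosedη : Prop :=
  ∀ (x : M) (X Y : Π x : M, TangentSpace 𝓘(ℝ, E) x),
    MDiffAt (T% X) x → MDiffAt (T% Y) x → A.dη X Y x = 0

/-- `α`-cosymplectic: normal, `dη = 0` and `dΦ = 2α η ∧ Φ`. -/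
structure IsAlphaCosymplectic (α : ℝ) : Prop where
  normal : A.IsNormal
  closed_η : A.IsClosedη
  dΦ_eq : ∀ (x : M) (X Y Z : Π x : M, TangentSpace 𝓘(ℝ, E) x),
    MDiffAt (T% X) x → MDiffAt (T% Y) x → MDiffAt (T% Z) x →
      A.dΦ X Y Z x = 2 * α * A.wedge x (X x) (Y x) (Z x)

/-- Cosymplectic: normal, `dη = 0` and `dΦ = 0`. -/
structure IsCosymplectic : Prop where
  normal : A.IsNormal
  closed_η : A.IsClosedη
  closed_Φ : ∀ (x : M) (X Y Z : Π x : M, TangentSpace 𝓘(ℝ, E) x),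
    MDiffAt (T% X) x → MDiffAt (T% Y) x → MDiffAt (T% Z) x → A.dΦ X Y Z x = 0

/-- A quarter-symmetric metric connection of the almost contact metric structure: a smooth metric
connection with torsion `T(u, v) = η(v) φ u - η(u) φ v`. -/
structure IsQuarterSymmetricMetric [IsContMDiffRiemannianBundle 𝓘(ℝ, E) ∞ E
      (fun x : M ↦ TangentSpace 𝓘(ℝ, E) x)]
    (cov : CovariantDerivative 𝓘(ℝ, E) E (TangentSpace 𝓘(ℝ, E) : M → Type _)) : Prop where
  smooth : CovariantDerivative.ContMDiffCovariantDerivative cov ∞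
  metric : CovariantDerivative.IsMetricCompatible (V := fun x : M ↦ TangentSpace 𝓘(ℝ, E) x) cov
  torsion_eq : ∀ x u v, cov.torsion x u v = A.η x v • A.φ x u - A.η x u • A.φ x v

/-- The `*`-Ricci tensor `S*(u, v) = ½ trace (w ↦ R(u, φ v) φ w)`. -/
def starRicci (cov : CovariantDerivative 𝓘(ℝ, E) E (TangentSpace 𝓘(ℝ, E) : M → Type _))
    (x : M) (u v : TangentSpace 𝓘(ℝ, E) x) : ℝ :=
  1 / 2 * metricTrace x fun w w' ↦ inner ℝ (curvature cov x u (A.φ x v) (A.φ x w)) w'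

/-- The `*`-scalar curvature `r*`, the trace of the `*`-Ricci tensor. -/
def starScalar (cov : CovariantDerivative 𝓘(ℝ, E) E (TangentSpace 𝓘(ℝ, E) : M → Type _))
    (x : M) : ℝ :=
  metricTrace x (A.starRicci cov x)

/-- The metric is a `*`-`η`-Ricci-Yamabe soliton with constants `ρ, q, Λ, μ` with respect to its
Levi-Civita connection `cov`: `£_ξ g + 2ρ S* + (2Λ - q r*) g + 2μ η ⊗ η = 0`. -/
def IsSoliton (cov : CovariantDerivative 𝓘(ℝ, E) E (TangentSpace 𝓘(ℝ, E) : M → Type _))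
    (ρ q Λ μ : ℝ) : Prop :=
  ∀ (x : M) (Y Z : Π x : M, TangentSpace 𝓘(ℝ, E) x), MDiffAt (T% Y) x → MDiffAt (T% Z) x →
    lieDerivMetric A.ξ Y Z x + 2 * ρ * A.starRicci cov x (Y x) (Z x)
      + (2 * Λ - q * A.starScalar cov x) * inner ℝ (Y x) (Z x)
      + 2 * μ * (A.η x (Y x) * A.η x (Z x)) = 0

/-- The metric of an `α`-cosymplectic manifold of dimension `n` is a `*`-`η`-Ricci-Yamabe soliton
with constants `ρ, q, Λ, μ` with respect to the quarter-symmetric metric connection `cov`: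
`£̃_ξ g + 2ρ S̃ + (2Λ + 2α²ρ(n-2) - q r̃ - qα²(n-1)²) g + (2μ + 2α²ρ) η ⊗ η = 0`, where the Lie
derivative, the Ricci tensor `S̃` and the scalar curvature `r̃` are those of `cov`. In other words,
`S̃ + α²(n-2) g + α² η ⊗ η` and its trace `r̃ + α²(n-1)²` are taken for `S*` and `r*`. -/
def IsQuarterSoliton (cov : CovariantDerivative 𝓘(ℝ, E) E (TangentSpace 𝓘(ℝ, E) : M → Type _))
    (α ρ q Λ μ : ℝ) : Prop :=
  ∀ (x : M) (u v : TangentSpace 𝓘(ℝ, E) x),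
    lieDerivMetricWrt cov A.ξ x u v + 2 * ρ * ricci cov x u v
      + (2 * Λ + 2 * α ^ 2 * ρ * ((Module.finrank ℝ E : ℝ) - 2) - q * scalarCurvature cov x
          - q * α ^ 2 * ((Module.finrank ℝ E : ℝ) - 1) ^ 2) * inner ℝ u v
      + (2 * μ + 2 * α ^ 2 * ρ) * (A.η x u * A.η x v) = 0

end AlmostContactMetric

end Riemannian

end StarRicciYamabe

end

/-!
On an `α`-cosymplectic manifold the Ricci tensor of the quarter-symmetric metric connection has the
skew part `α Φ`, while all other terms of the soliton equation for that connection are symmetric. As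
`Φ ≠ 0`, the equation forces `α = 0`; and when `α = 0`, it is the soliton equation for `∇`.

*The structure equations.* For the Levi-Civita connection,
`∇_u ξ = α (u - η(u) ξ)` and `(∇_u φ) v = α (g(φ u, v) ξ - η(v) φ u)`
(`IsAlphaCosymplectic.structure_equations`). Normality, `dη = 0` and `dΦ = 2α η ∧ Φ` are rewritten
in terms of `∇φ` and `∇ξ` at a point, after which the claim is linear algebra
(`structure_equations`): the component along `ξ` determines `∇ξ`, and the difference `Q` between
`∇φ` and its asserted value satisfies the same identities with `α = 0`, whence `Q = 0` by the
argument showing that almost Hermitian manifolds with `N = 0` and `dΦ = 0` are Kähler.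

*Comparison of the connections.* A metric connection is determined by its torsion, so
`∇̃_u Z = ∇_u Z - η(u) φ Z` (`IsQuarterSymmetricMetric.cov_eq`). As `dη = 0`, the structure
equations give `S̃ = S + α Φ` (`IsQuarterSymmetricMetric.ricci_eq`). The skew part of the soliton
equation for `∇̃` is therefore `2ρα Φ = 0` (`IsQuarterSoliton.alpha_eq_zero`).

*The converse.* If `α = 0`, then `∇φ = 0`, so `R(u, v)` commutes with `φ`, and the first Bianchi
identity gives `S* = S` (`starRicci_eq_ricci`). Since also `S̃ = S` and `∇̃ξ = ∇ξ`, the two soliton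
equations coincide (`IsSoliton.isQuarterSoliton`).

The symmetries of `R` are proved for globally smooth vector fields. The skew-adjointness of
`R(X, Y)` rests on `X(Y f) - Y(X f) = [X, Y] f`, which is obtained from the Jacobi identity for
`X`, `Y` and `f • Z` (`mvfderiv_mvfderiv_sub`). It implies that `R(X, Y) Z` depends on `Z` only
through its value at the point, and pair symmetry extends this to `X` and `Y` (`curvatureField_congr`).
-/

namespace StarRicciYamabe

/-! ### Smooth vector fields -/

section Fields

variable {E : Type*} [NormedAddCommGroup E] [NormedSpace ℝ E]
  {M : Type*} [TopologicalSpace M] [ChartedSpace E M] [IsManifold 𝓘(ℝ, E) ∞ M]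

lemma two_le_infty : (2 : ℕ∞ω) ≤ ∞ := WithTop.coe_le_coe.2 (le_top : (2 : ℕ∞) ≤ ⊤)

lemma three_le_infty : (3 : ℕ∞ω) ≤ ∞ := WithTop.coe_le_coe.2 (le_top : (3 : ℕ∞) ≤ ⊤)

/-- A vector field that is smooth on the whole manifold. -/
def SmoothField (X : Π x : M, TangentSpace 𝓘(ℝ, E) x) : Prop := CMDiff ∞ (T% X)

namespace SmoothField

variable {X Y : Π x : M, TangentSpace 𝓘(ℝ, E) x}

lemma mdiffAt (hX : SmoothField X) (x : M) : MDiffAt (T% X) x :=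
  (hX x).mdifferentiableAt (by simp)

lemma add (hX : SmoothField X) (hY : SmoothField Y) : SmoothField (X + Y) :=
  ContMDiff.add_section hX hY

lemma smul (hX : SmoothField X) {f : M → ℝ} (hf : CMDiff ∞ f) : SmoothField (f • X) :=
  ContMDiff.smul_section hf hX

lemma const_smul (hX : SmoothField X) (c : ℝ) : SmoothField (c • X) :=
  ContMDiff.const_smul_section hX

lemma clm_apply (hX : SmoothField X)
    {φ : Π x : M, TangentSpace 𝓘(ℝ, E) x →L[ℝ] TangentSpace 𝓘(ℝ, E) x}
    (hφ : ContMDiff 𝓘(ℝ, E) (𝓘(ℝ, E).prod 𝓘(ℝ, E →L[ℝ] E)) ∞ fun x ↦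
      (⟨x, φ x⟩ : TotalSpace (E →L[ℝ] E)
        fun x : M ↦ TangentSpace 𝓘(ℝ, E) x →L[ℝ] TangentSpace 𝓘(ℝ, E) x)) :
    SmoothField (fun x ↦ φ x (X x)) :=
  ContMDiff.clm_bundle_apply hφ hX

lemma mlieBracket [CompleteSpace E] (hX : SmoothField X) (hY : SmoothField Y) :
    SmoothField (VectorField.mlieBracket 𝓘(ℝ, E) X Y) :=
  have : IsManifold 𝓘(ℝ, E) ((⊤ : ℕ∞) + 1) M := ‹IsManifold 𝓘(ℝ, E) ∞ M›
  have : IsManifold 𝓘(ℝ, E) (minSmoothness ℝ 2) M :=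
    IsManifold.of_le (n := ∞) (by simpa using two_le_infty)
  ContDiff.mlieBracket_vectorField (m := ⊤) (n := ⊤) hX hY (by simp)

lemma cov {cov : CovariantDerivative 𝓘(ℝ, E) E (TangentSpace 𝓘(ℝ, E) : M → Type _)}
    (hcov : CovariantDerivative.ContMDiffCovariantDerivative cov ∞)
    (hX : SmoothField X) (hY : SmoothField Y) : SmoothField (fun x ↦ cov Y x (X x)) := by
  have := hcov.contMDiff.contMDiff (σ := Y) (by simpa using! hY.contMDiffOn)
  rw [contMDiffOn_univ] at this
  exact ContMDiff.clm_bundle_apply this hX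

end SmoothField

/-- Mathlib's extension of a tangent vector agrees near the base point with a globally smooth
field. -/
lemma exists_smoothField_eventuallyEq_extend [FiniteDimensional ℝ E] [T2Space M] {x : M}
    (u : TangentSpace 𝓘(ℝ, E) x) :
    ∃ X : Π y : M, TangentSpace 𝓘(ℝ, E) y, SmoothField X ∧ X x = u ∧
      X =ᶠ[nhds x] (FiberBundle.extend E u : Π y : M, TangentSpace 𝓘(ℝ, E) y) := by
  obtain ⟨s, hs, hsX⟩ := FiberBundle.exists_contMDiffOn_extend (k := ∞) 𝓘(ℝ, E) E u
  obtain ⟨t, hts, hto, hxt⟩ := mem_nhds_iff.1 hs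
  obtain ⟨f, -, hf⟩ := (SmoothBumpFunction.nhds_basis_tsupport (I := 𝓘(ℝ, E)) x).mem_iff.1
    (hto.mem_nhds hxt)
  have hev : (f : M → ℝ) • (FiberBundle.extend E u : Π y : M, TangentSpace 𝓘(ℝ, E) y) =ᶠ[nhds x]
      (FiberBundle.extend E u : Π y : M, TangentSpace 𝓘(ℝ, E) y) := by
    filter_upwards [f.eventuallyEq_one] with y hy
    simp only [Pi.smul_apply', hy, Pi.one_apply, one_smul]
    rfl
  refine ⟨(f : M → ℝ) • FiberBundle.extend E u, ?_, ?_, hev⟩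
  · have := ContMDiffOn.smul_section_of_tsupport (V := fun y : M ↦ TangentSpace 𝓘(ℝ, E) y)
      f.contMDiff.contMDiffOn hto hf (hsX.mono hts)
    exact this
  · rw [hev.eq_of_nhds]; simp

/-- Derivatives of functions along vector fields commute up to the Lie bracket. This follows from
the Jacobi identity for `X`, `Y` and `f • Z`, where `Z` is a field that does not vanish at the
point. -/
lemma mvfderiv_mvfderiv_sub [CompleteSpace E] {X Y : Π x : M, TangentSpace 𝓘(ℝ, E) x} {f : M → ℝ}
    (hX : SmoothField X) (hY : SmoothField Y) (hf : CMDiff ∞ f)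
    (hXf : CMDiff ∞ (fun y ↦ mvfderiv 𝓘(ℝ, E) f y (X y)))
    (hYf : CMDiff ∞ (fun y ↦ mvfderiv 𝓘(ℝ, E) f y (Y y))) (x : M) :
    mvfderiv 𝓘(ℝ, E) (fun y ↦ mvfderiv 𝓘(ℝ, E) f y (Y y)) x (X x)
      - mvfderiv 𝓘(ℝ, E) (fun y ↦ mvfderiv 𝓘(ℝ, E) f y (X y)) x (Y x)
      = mvfderiv 𝓘(ℝ, E) f x (VectorField.mlieBracket 𝓘(ℝ, E) X Y x) := by
  have key (Z : Π x : M, TangentSpace 𝓘(ℝ, E) x) (hZ : SmoothField Z) (hZx : Z x ≠ 0) :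
      mvfderiv 𝓘(ℝ, E) (fun y ↦ mvfderiv 𝓘(ℝ, E) f y (Y y)) x (X x)
      - mvfderiv 𝓘(ℝ, E) (fun y ↦ mvfderiv 𝓘(ℝ, E) f y (X y)) x (Y x)
      = mvfderiv 𝓘(ℝ, E) f x (VectorField.mlieBracket 𝓘(ℝ, E) X Y x) := by
    have hmd {g : M → ℝ} (hg : CMDiff ∞ g) (y : M) : MDiffAt g y :=
      (hg y).mdifferentiableAt (by simp)
    have h1 (V : Π x : M, TangentSpace 𝓘(ℝ, E) x) :
        VectorField.mlieBracket 𝓘(ℝ, E) V (f • Z) =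
        (fun y ↦ mvfderiv 𝓘(ℝ, E) f y (V y)) • Z + f • VectorField.mlieBracket 𝓘(ℝ, E) V Z := by
      ext1 y
      exact VectorField.mlieBracket_smul_right (hmd hf y) (hZ.mdiffAt y)
    have : IsManifold 𝓘(ℝ, E) (minSmoothness ℝ 3) M :=
      IsManifold.of_le (n := ∞) (by simpa using three_le_infty)
    have hle {V : Π x : M, TangentSpace 𝓘(ℝ, E) x} (hV : SmoothField V) :
        CMDiffAt (minSmoothness ℝ 2) (T% V) x := (hV x).of_le (by simpa using two_le_infty)
    have J1 := VectorField.leibniz_identity_mlieBracket_apply (hle hX) (hle hY) (hle (hZ.smul hf))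
    have J2 := VectorField.leibniz_identity_mlieBracket_apply (hle hX) (hle hY) (hle hZ)
    rw [h1, h1, h1] at J1
    rw [VectorField.mlieBracket_add_right ((hZ.smul hYf).mdiffAt x)
        (((hY.mlieBracket hZ).smul hf).mdiffAt x),
      VectorField.mlieBracket_add_right ((hZ.smul hXf).mdiffAt x)
        (((hX.mlieBracket hZ).smul hf).mdiffAt x),
      VectorField.mlieBracket_smul_right (hmd hYf x) (hZ.mdiffAt x),
      VectorField.mlieBracket_smul_right (hmd hXf x) (hZ.mdiffAt x),
      VectorField.mlieBracket_smul_right (hmd hf x) ((hY.mlieBracket hZ).mdiffAt x),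
      VectorField.mlieBracket_smul_right (hmd hf x) ((hX.mlieBracket hZ).mdiffAt x), J2] at J1
    simp only [Pi.add_apply, Pi.smul_apply', smul_add] at J1
    refine smul_left_injective ℝ hZx ?_
    simp only [sub_smul]
    linear_combination (norm := module) J1
  by_cases hXx : X x = 0
  · by_cases hYx : Y x = 0
    · have : VectorField.mlieBracket 𝓘(ℝ, E) X Y x = 0 := by
        rw [← VectorField.mlieBracketWithin_univ]
        exact VectorField.mlieBracketWithin_eq_zero_of_eq_zero hXx hYx
      rw [hXx, hYx, this]; simp
    · exact key Y hY hYx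
  · exact key X hX hXx

end Fields

/-! ### Symmetries of the curvature of a Levi-Civita connection -/

section Curvature

open VectorField

variable {E : Type*} [NormedAddCommGroup E] [NormedSpace ℝ E]
  {M : Type*} [TopologicalSpace M] [ChartedSpace E M] [IsManifold 𝓘(ℝ, E) ∞ M]
  {cov : CovariantDerivative 𝓘(ℝ, E) E (TangentSpace 𝓘(ℝ, E) : M → Type _)}
  {X Y Z W X' Y' Z' W' : Π x : M, TangentSpace 𝓘(ℝ, E) x}

lemma cov_add (hX : SmoothField X) (hY : SmoothField Y) (x : M) :
    cov (X + Y) x = cov X x + cov Y x :=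
  cov.isCovariantDerivativeOnUniv.add (hX.mdiffAt x) (hY.mdiffAt x)

lemma cov_const_smul (c : ℝ) (hX : SmoothField X) (x : M) :
    cov (c • X) x = c • cov X x :=
  cov.isCovariantDerivativeOnUniv.smul_const c (hX.mdiffAt x)

lemma cov_smul {f : M → ℝ} (hf : CMDiff ∞ f) (hX : SmoothField X) (x : M)
    (u : TangentSpace 𝓘(ℝ, E) x) :
    cov (f • X) x u = f x • cov X x u + mvfderiv 𝓘(ℝ, E) f x u • X x := by
  rw [cov.isCovariantDerivativeOnUniv.leibniz (hX.mdiffAt x)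
    ((hf x).mdifferentiableAt (by simp))]
  rfl

/-- The curvature tensor can be computed with globally smooth extensions. -/
lemma curvature_eq_curvatureField (hcov : CovariantDerivative.ContMDiffCovariantDerivative cov ∞)
    {x : M} {u v w : TangentSpace 𝓘(ℝ, E) x}
    (hX : SmoothField X) (hY : SmoothField Y) (hZ : SmoothField Z)
    (hXu : X =ᶠ[nhds x] (FiberBundle.extend E u : Π y : M, TangentSpace 𝓘(ℝ, E) y))
    (hYv : Y =ᶠ[nhds x] (FiberBundle.extend E v : Π y : M, TangentSpace 𝓘(ℝ, E) y))
    (hZw : Z =ᶠ[nhds x] (FiberBundle.extend E w : Π y : M, TangentSpace 𝓘(ℝ, E) y)) :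
    curvature cov x u v w = curvatureField cov X Y Z x := by
  have congr_near {V V' : Π x : M, TangentSpace 𝓘(ℝ, E) x} (hV : SmoothField V)
      (h : V =ᶠ[nhds x] V') : ∀ᶠ y in nhds x, cov V y = cov V' y := by
    filter_upwards [h.eventuallyEq_nhds] with y hy
    have hy' : (T% V') =ᶠ[nhds y] (T% V) := by
      filter_upwards [hy] with z hz using by rw [hz]
    exact cov.isCovariantDerivativeOnUniv.congr_of_eventuallyEq (hV.mdiffAt y)
      ((hV.mdiffAt y).congr_of_eventuallyEq hy') Filter.univ_mem hy
  have congr_second {V V' : Π x : M, TangentSpace 𝓘(ℝ, E) x} (hV : SmoothField V)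
      (h : V =ᶠ[nhds x] V') : cov (fun y ↦ cov Z y (V y)) x =
        cov (fun y ↦ cov (FiberBundle.extend E w) y (V' y)) x := by
    refine (congr_near (hV.cov hcov hZ) ?_).self_of_nhds
    filter_upwards [congr_near hZ hZw, h] with y hy hy'
    rw [hy, hy']
  simp only [curvature, curvatureField]
  rw [← congr_second hX hXu, ← congr_second hY hYv, ← (congr_near hZ hZw).self_of_nhds,
    hXu.symm.mlieBracket_vectorField_eq hYv.symm, ← hXu.eq_of_nhds, ← hYv.eq_of_nhds]

lemma curvatureField_swap (X Y Z : Π x : M, TangentSpace 𝓘(ℝ, E) x) (x : M) :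
    curvatureField cov Y X Z x = -curvatureField cov X Y Z x := by
  simp only [curvatureField]
  rw [mlieBracket_swap_apply, map_neg]
  abel

lemma curvatureField_add (hcov : CovariantDerivative.ContMDiffCovariantDerivative cov ∞)
    (hX : SmoothField X) (hY : SmoothField Y) (hZ : SmoothField Z) (hZ' : SmoothField Z')
    (x : M) : curvatureField cov X Y (Z + Z') x =
      curvatureField cov X Y Z x + curvatureField cov X Y Z' x := by
  have h (V : Π x : M, TangentSpace 𝓘(ℝ, E) x) :
      (fun y ↦ cov (Z + Z') y (V y)) = (fun y ↦ cov Z y (V y)) + (fun y ↦ cov Z' y (V y)) := by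
    ext1 y
    simp [cov_add hZ hZ']
  simp only [curvatureField]
  rw [h, h, cov_add (hX.cov hcov hZ) (hX.cov hcov hZ'),
    cov_add (hY.cov hcov hZ) (hY.cov hcov hZ'), cov_add hZ hZ']
  simp only [add_apply]
  abel

lemma curvatureField_const_smul (hcov : CovariantDerivative.ContMDiffCovariantDerivative cov ∞)
    (hX : SmoothField X) (hY : SmoothField Y) (hZ : SmoothField Z) (c : ℝ)
    (x : M) : curvatureField cov X Y (c • Z) x = c • curvatureField cov X Y Z x := by
  have h (V : Π x : M, TangentSpace 𝓘(ℝ, E) x) :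
      (fun y ↦ cov (c • Z) y (V y)) = c • (fun y ↦ cov Z y (V y)) := by
    ext1 y
    simp [cov_const_smul c hZ]
  simp only [curvatureField]
  rw [h, h, cov_const_smul c (hX.cov hcov hZ), cov_const_smul c (hY.cov hcov hZ),
    cov_const_smul c hZ]
  simp only [smul_apply, smul_sub]

variable [RiemannianBundle (fun x : M ↦ TangentSpace 𝓘(ℝ, E) x)]
  [IsContMDiffRiemannianBundle 𝓘(ℝ, E) ∞ E (fun x : M ↦ TangentSpace 𝓘(ℝ, E) x)]

lemma SmoothField.inner (hX : SmoothField X) (hY : SmoothField Y) :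
    CMDiff ∞ (fun y ↦ (Inner.inner ℝ (X y) (Y y) : ℝ)) :=
  ContMDiff.inner_bundle (n := ∞) (E := fun x : M ↦ TangentSpace 𝓘(ℝ, E) x) hX hY

variable [FiniteDimensional ℝ E]

/-- The curvature of a metric connection is skew-adjoint. -/
lemma inner_curvatureField_add_inner
    (hcov : CovariantDerivative.ContMDiffCovariantDerivative cov ∞)
    (hm : CovariantDerivative.IsMetricCompatible (V := fun x : M ↦ TangentSpace 𝓘(ℝ, E) x) cov)
    (hX : SmoothField X) (hY : SmoothField Y) (hZ : SmoothField Z) (hW : SmoothField W) (x : M) :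
    (inner ℝ (curvatureField cov X Y Z x) (W x) : ℝ)
      + inner ℝ (Z x) (curvatureField cov X Y W x) = 0 := by
  have hd {V P Q : Π x : M, TangentSpace 𝓘(ℝ, E) x} (hP : SmoothField P) (hQ : SmoothField Q)
      (y : M) : mvfderiv 𝓘(ℝ, E) (fun z ↦ (inner ℝ (P z) (Q z) : ℝ)) y (V y) =
        inner ℝ (cov P y (V y)) (Q y) + inner ℝ (P y) (cov Q y (V y)) :=
    hm.mvfderiv_inner_eq V (hP.mdiffAt y) (hQ.mdiffAt y)
  have hcd {P Q : Π x : M, TangentSpace 𝓘(ℝ, E) x} (hP : SmoothField P) (hQ : SmoothField Q)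
      (y : M) : MDiffAt (fun z ↦ (inner ℝ (P z) (Q z) : ℝ)) y :=
    (hP.inner hQ y).mdifferentiableAt (by simp)
  have hd1 (V : Π x : M, TangentSpace 𝓘(ℝ, E) x) :
      (fun y ↦ mvfderiv 𝓘(ℝ, E) (fun z ↦ (inner ℝ (Z z) (W z) : ℝ)) y (V y)) =
      (fun y ↦ (inner ℝ (cov Z y (V y)) (W y) : ℝ)) + fun y ↦ inner ℝ (Z y) (cov W y (V y)) := by
    ext1 y
    exact hd hZ hW y
  have hs {V : Π x : M, TangentSpace 𝓘(ℝ, E) x} (hV : SmoothField V) :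
      CMDiff ∞ (fun y ↦ mvfderiv 𝓘(ℝ, E) (fun z ↦ (inner ℝ (Z z) (W z) : ℝ)) y (V y)) := by
    rw [hd1]
    exact ((hV.cov hcov hZ).inner hW).add (hZ.inner (hV.cov hcov hW))
  have h2 {U V : Π x : M, TangentSpace 𝓘(ℝ, E) x} (hV : SmoothField V) :
      mvfderiv 𝓘(ℝ, E) (fun y ↦ mvfderiv 𝓘(ℝ, E) (fun z ↦ (inner ℝ (Z z) (W z) : ℝ)) y (V y))
        x (U x) =
      inner ℝ (cov (fun y ↦ cov Z y (V y)) x (U x)) (W x)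
        + inner ℝ (cov Z x (V x)) (cov W x (U x)) + (inner ℝ (cov Z x (U x)) (cov W x (V x))
        + inner ℝ (Z x) (cov (fun y ↦ cov W y (V y)) x (U x))) := by
    rw [hd1, mvfderiv_add (hcd (hV.cov hcov hZ) hW x) (hcd hZ (hV.cov hcov hW) x),
      add_apply, hd (hV.cov hcov hZ) hW, hd hZ (hV.cov hcov hW)]
  have key := mvfderiv_mvfderiv_sub hX hY (hZ.inner hW) (hs hX) (hs hY) x
  rw [h2 hX, h2 hY, hd hZ hW x] at key
  simp only [curvatureField, inner_sub_left, inner_sub_right]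
  linear_combination key

/-- The first Bianchi identity. -/
lemma curvatureField_bianchi (hlc : IsLeviCivita cov)
    (hX : SmoothField X) (hY : SmoothField Y) (hZ : SmoothField Z) (x : M) :
    curvatureField cov X Y Z x + curvatureField cov Y Z X x + curvatureField cov Z X Y x = 0 := by
  have ht {P Q : Π x : M, TangentSpace 𝓘(ℝ, E) x} (hP : SmoothField P) (hQ : SmoothField Q)
      (y : M) : cov Q y (P y) - cov P y (Q y) = mlieBracket 𝓘(ℝ, E) P Q y :=
    (cov.torsion_eq_zero_iff.1 hlc.torsion_free) (hP.mdiffAt y) (hQ.mdiffAt y)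
  have hb {P Q V : Π x : M, TangentSpace 𝓘(ℝ, E) x} (hP : SmoothField P) (hQ : SmoothField Q)
      (hV : SmoothField V) : mlieBracket 𝓘(ℝ, E) V (mlieBracket 𝓘(ℝ, E) P Q) x =
        cov (fun y ↦ cov Q y (P y)) x (V x) - cov (fun y ↦ cov P y (Q y)) x (V x)
          - cov V x (mlieBracket 𝓘(ℝ, E) P Q x) := by
    have h : (fun y ↦ cov Q y (P y)) = (fun y ↦ cov P y (Q y)) + mlieBracket 𝓘(ℝ, E) P Q := by
      ext1 y
      simp [← ht hP hQ y]
    rw [h, cov_add (hQ.cov hlc.smooth hP) (hP.mlieBracket hQ),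
      ← ht hV (hP.mlieBracket hQ)]
    simp only [add_apply]
    abel
  have : IsManifold 𝓘(ℝ, E) (minSmoothness ℝ 3) M :=
    IsManifold.of_le (n := ∞) (by simpa using three_le_infty)
  have hle {V : Π x : M, TangentSpace 𝓘(ℝ, E) x} (hV : SmoothField V) :
      CMDiffAt (minSmoothness ℝ 2) (T% V) x := (hV x).of_le (by simpa using two_le_infty)
  have J := leibniz_identity_mlieBracket_apply (hle hX) (hle hY) (hle hZ)
  rw [mlieBracket_swap_apply (V := mlieBracket 𝓘(ℝ, E) X Y), hb hY hZ hX, hb hX hY hZ,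
    hb hX hZ hY, mlieBracket_swap_apply (V := X) (W := Z), map_neg] at J
  simp only [curvatureField]
  linear_combination (norm := module) J

/-- The `(0,4)` curvature of a Levi-Civita connection has the pair symmetry. -/
lemma inner_curvatureField_pair_symm (hlc : IsLeviCivita cov)
    (hX : SmoothField X) (hY : SmoothField Y) (hZ : SmoothField Z) (hW : SmoothField W) (x : M) :
    (inner ℝ (curvatureField cov X Y Z x) (W x) : ℝ)
      = inner ℝ (curvatureField cov Z W X x) (Y x) := by
  have sk {A B C D : Π x : M, TangentSpace 𝓘(ℝ, E) x} (hA : SmoothField A) (hB : SmoothField B)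
      (hC : SmoothField C) (hD : SmoothField D) :
      (inner ℝ (curvatureField cov A B C x) (D x) : ℝ)
        = -inner ℝ (curvatureField cov A B D x) (C x) := by
    have := inner_curvatureField_add_inner hlc.smooth hlc.metric hA hB hC hD x
    rw [real_inner_comm _ (C x)] at this
    linarith
  have sw (A B C D : Π x : M, TangentSpace 𝓘(ℝ, E) x) :
      (inner ℝ (curvatureField cov A B C x) (D x) : ℝ)
        = -inner ℝ (curvatureField cov B A C x) (D x) := by
    rw [curvatureField_swap, inner_neg_left]
  have bi {A B C D : Π x : M, TangentSpace 𝓘(ℝ, E) x} (hA : SmoothField A) (hB : SmoothField B)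
      (hC : SmoothField C) :
      (inner ℝ (curvatureField cov A B C x) (D x) : ℝ)
        + inner ℝ (curvatureField cov B C A x) (D x)
        + inner ℝ (curvatureField cov C A B x) (D x) = 0 := by
    rw [← inner_add_left, ← inner_add_left, curvatureField_bianchi hlc hA hB hC, inner_zero_left]
  have b1 := bi (D := W) hX hY hZ
  have b2 := bi (D := X) hY hZ hW
  have b3 := bi (D := Y) hZ hW hX
  have b4 := bi (D := Z) hW hX hY
  have s1 := sk hY hZ hX hW
  have s2 := sk hZ hX hY hW
  have s3 := sk hX hY hZ hW
  have s4 := sk hZ hW hX hY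
  have s5 := sk hW hX hY hZ
  have s6 := sk hW hY hX hZ
  have t1 := sw X Z W Y
  have t2 := sw W Y X Z
  linarith

/-- The value at a point of the curvature of smooth vector fields depends only on the values of the
fields: skew-adjointness gives this for the third field, and pair symmetry for the other two. -/
lemma curvatureField_congr (hlc : IsLeviCivita cov) [T2Space M]
    (hX : SmoothField X) (hY : SmoothField Y) (hZ : SmoothField Z)
    (hX' : SmoothField X') (hY' : SmoothField Y') (hZ' : SmoothField Z') {x : M}
    (eX : X x = X' x) (eY : Y x = Y' x) (eZ : Z x = Z' x) :
    curvatureField cov X Y Z x = curvatureField cov X' Y' Z' x := by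
  refine ext_inner_right ℝ fun w ↦ ?_
  obtain ⟨W, hW, rfl, -⟩ := exists_smoothField_eventuallyEq_extend w
  have third {A B C C' D : Π x : M, TangentSpace 𝓘(ℝ, E) x} (hA : SmoothField A)
      (hB : SmoothField B) (hC : SmoothField C) (hC' : SmoothField C') (hD : SmoothField D)
      (e : C x = C' x) : (inner ℝ (curvatureField cov A B C x) (D x) : ℝ) =
        inner ℝ (curvatureField cov A B C' x) (D x) := by
    have h1 := inner_curvatureField_add_inner hlc.smooth hlc.metric hA hB hC hD x
    have h2 := inner_curvatureField_add_inner hlc.smooth hlc.metric hA hB hC' hD x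
    rw [e] at h1
    linarith
  rw [third hX hY hZ hZ' hW eZ, inner_curvatureField_pair_symm hlc hX hY hZ' hW,
    third hZ' hW hX hX' hY eX, eY,
    inner_curvatureField_pair_symm hlc hZ' hW hX' hY']

end Curvature

/-! ### The curvature tensor at a point -/

section PointwiseCurvature

variable {E : Type*} [NormedAddCommGroup E] [NormedSpace ℝ E] [FiniteDimensional ℝ E]
  {M : Type*} [TopologicalSpace M] [T2Space M] [ChartedSpace E M] [IsManifold 𝓘(ℝ, E) ∞ M]

/-- A globally smooth extension of a tangent vector, equal to Mathlib's extension near the base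
point. -/
noncomputable def smoothExt {x : M} (u : TangentSpace 𝓘(ℝ, E) x) :
    Π y : M, TangentSpace 𝓘(ℝ, E) y :=
  (exists_smoothField_eventuallyEq_extend u).choose

lemma smoothField_smoothExt {x : M} (u : TangentSpace 𝓘(ℝ, E) x) : SmoothField (smoothExt u) :=
  (exists_smoothField_eventuallyEq_extend u).choose_spec.1

@[simp]
lemma smoothExt_apply_self {x : M} (u : TangentSpace 𝓘(ℝ, E) x) : smoothExt u x = u :=
  (exists_smoothField_eventuallyEq_extend u).choose_spec.2.1

lemma curvature_eq_smoothExt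
    {cov : CovariantDerivative 𝓘(ℝ, E) E (TangentSpace 𝓘(ℝ, E) : M → Type _)}
    (hcov : CovariantDerivative.ContMDiffCovariantDerivative cov ∞)
    {x : M} (u v w : TangentSpace 𝓘(ℝ, E) x) : curvature cov x u v w =
      curvatureField cov (smoothExt u) (smoothExt v) (smoothExt w) x :=
  curvature_eq_curvatureField hcov (smoothField_smoothExt u) (smoothField_smoothExt v)
    (smoothField_smoothExt w) (exists_smoothField_eventuallyEq_extend u).choose_spec.2.2
    (exists_smoothField_eventuallyEq_extend v).choose_spec.2.2
    (exists_smoothField_eventuallyEq_extend w).choose_spec.2.2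

variable [RiemannianBundle (fun x : M ↦ TangentSpace 𝓘(ℝ, E) x)]
  [IsContMDiffRiemannianBundle 𝓘(ℝ, E) ∞ E (fun x : M ↦ TangentSpace 𝓘(ℝ, E) x)]
  {lc : CovariantDerivative 𝓘(ℝ, E) E (TangentSpace 𝓘(ℝ, E) : M → Type _)}

lemma curvature_apply (hlc : IsLeviCivita lc) {X Y Z : Π x : M, TangentSpace 𝓘(ℝ, E) x}
    (hX : SmoothField X) (hY : SmoothField Y) (hZ : SmoothField Z) (x : M) :
    curvature lc x (X x) (Y x) (Z x) = curvatureField lc X Y Z x := by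
  rw [curvature_eq_smoothExt hlc.smooth]
  exact curvatureField_congr hlc (smoothField_smoothExt _) (smoothField_smoothExt _)
    (smoothField_smoothExt _) hX hY hZ (by simp) (by simp) (by simp)

variable {x : M} (u v w z : TangentSpace 𝓘(ℝ, E) x)

lemma curvature_swap (hlc : IsLeviCivita lc) : curvature lc x v u w = -curvature lc x u v w := by
  simp only [curvature_eq_smoothExt hlc.smooth]
  rw [curvatureField_swap]

lemma curvature_bianchi (hlc : IsLeviCivita lc) :
    curvature lc x u v w + curvature lc x v w u + curvature lc x w u v = 0 := by
  simp only [curvature_eq_smoothExt hlc.smooth]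
  exact curvatureField_bianchi hlc (smoothField_smoothExt _) (smoothField_smoothExt _)
    (smoothField_smoothExt _) x

lemma inner_curvature_skew (hlc : IsLeviCivita lc) :
    (inner ℝ (curvature lc x u v w) z : ℝ) = -inner ℝ (curvature lc x u v z) w := by
  have := inner_curvatureField_add_inner hlc.smooth hlc.metric (smoothField_smoothExt u)
    (smoothField_smoothExt v) (smoothField_smoothExt w) (smoothField_smoothExt z) x
  rw [← curvature_eq_smoothExt hlc.smooth, ← curvature_eq_smoothExt hlc.smooth,
    smoothExt_apply_self, smoothExt_apply_self, real_inner_comm _ w] at this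
  linarith

lemma inner_curvature_pair_symm (hlc : IsLeviCivita lc) :
    (inner ℝ (curvature lc x u v w) z : ℝ) = inner ℝ (curvature lc x w z u) v := by
  have := inner_curvatureField_pair_symm hlc (smoothField_smoothExt u)
    (smoothField_smoothExt v) (smoothField_smoothExt w) (smoothField_smoothExt z) x
  rwa [← curvature_eq_smoothExt hlc.smooth, ← curvature_eq_smoothExt hlc.smooth,
    smoothExt_apply_self, smoothExt_apply_self] at this

lemma curvature_add_third (hlc : IsLeviCivita lc) :
    curvature lc x u v (w + z) = curvature lc x u v w + curvature lc x u v z := by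
  have hw := smoothField_smoothExt w
  have hz := smoothField_smoothExt z
  have := curvatureField_add hlc.smooth (smoothField_smoothExt u) (smoothField_smoothExt v) hw hz x
  rw [← curvature_apply hlc (smoothField_smoothExt u) (smoothField_smoothExt v) (hw.add hz)]
    at this
  simpa [← curvature_apply hlc, hw, hz, smoothField_smoothExt] using this

lemma curvature_smul_third (hlc : IsLeviCivita lc) (c : ℝ) :
    curvature lc x u v (c • w) = c • curvature lc x u v w := by
  have hw := smoothField_smoothExt w
  have := curvatureField_const_smul hlc.smooth (smoothField_smoothExt u)
    (smoothField_smoothExt v) hw c x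
  rw [← curvature_apply hlc (smoothField_smoothExt u) (smoothField_smoothExt v)
    (hw.const_smul c)] at this
  simpa [← curvature_apply hlc, hw, smoothField_smoothExt] using this

/-- The bilinear form `(u, z) ↦ g(R(u, v) w, z)`, whose trace is the Ricci tensor `S(v, w)`. -/
noncomputable def curvatureForm (hlc : IsLeviCivita lc) :
    TangentSpace 𝓘(ℝ, E) x →ₗ[ℝ] TangentSpace 𝓘(ℝ, E) x →ₗ[ℝ] ℝ :=
  LinearMap.mk₂ ℝ (fun u z ↦ (inner ℝ (curvature lc x u v w) z : ℝ))
    (fun u u' z ↦ by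
      simp only [inner_curvature_pair_symm (z := z) (hlc := hlc), curvature_add_third _ _ _ _ hlc,
        inner_add_left])
    (fun c u z ↦ by
      simp only [inner_curvature_pair_symm (z := z) (hlc := hlc), curvature_smul_third _ _ _ hlc,
        real_inner_smul_left, smul_eq_mul])
    (fun u z z' ↦ inner_add_right _ _ _)
    (fun c u z ↦ by rw [real_inner_smul_right, smul_eq_mul])

/-- The Ricci tensor of the Levi-Civita connection is symmetric. -/
lemma ricci_symm (hlc : IsLeviCivita lc) : ricci lc x v w = ricci lc x w v := by
  simp only [ricci, metricTrace]
  refine Finset.sum_congr rfl fun i _ ↦ ?_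
  rw [inner_curvature_pair_symm _ _ _ _ hlc, inner_curvature_skew _ _ _ _ hlc,
    curvature_swap _ _ _ hlc, inner_neg_left, neg_neg]

end PointwiseCurvature

/-! ### Linear algebra of the structure equations -/

section LinearAlgebra

variable {V : Type*} [NormedAddCommGroup V] [InnerProductSpace ℝ V]

/-- A trilinear form `g(B(v, u), w)` that is symmetric in `u, v` and skew in `v, w` vanishes. -/
lemma eq_zero_of_symm_of_skew {B : V → V → V} (hs : ∀ u v, B u v = B v u)
    (ha : ∀ u v w, (inner ℝ (B v u) w : ℝ) = -inner ℝ v (B w u)) (u v : V) : B v u = 0 := by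
  refine ext_inner_right ℝ fun w ↦ ?_
  have h1 := ha u v w
  have h2 := ha v w u
  have h3 := ha w u v
  rw [hs w u, real_inner_comm] at h1
  rw [hs u v, real_inner_comm] at h2
  rw [hs v w, real_inner_comm] at h3
  rw [inner_zero_left, real_inner_comm]
  linarith

variable {φ : V →L[ℝ] V} {ξ : V} {η : V →L[ℝ] ℝ} {D : V → V → V} {N : V → V} {α : ℝ}

/-- The algebra behind the structure equations of an `α`-cosymplectic manifold. At a point, `D u v`
stands for `(∇_u φ) v` and `N u` for `∇_u ξ`. The hypotheses are the pointwise consequences of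
the almost contact metric identities, of `dη = 0` (`closed`), of `dΦ = 2α η ∧ Φ` (`cyclic`) and of
normality. -/
theorem structure_equations
    (φ_φ : ∀ v, φ (φ v) = -v + η v • ξ) (η_ξ : η ξ = 1) (η_φ : ∀ v, η (φ v) = 0) (φ_ξ : φ ξ = 0)
    (inner_φ_φ : ∀ u v, (inner ℝ (φ u) (φ v) : ℝ) = inner ℝ u v - η u * η v)
    (inner_φ_right : ∀ u v, (inner ℝ u (φ v) : ℝ) = -inner ℝ (φ u) v)
    (inner_ξ : ∀ v, (inner ℝ v ξ : ℝ) = η v)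
    (D_zero : ∀ v, D 0 v = 0)
    (skew : ∀ u v w, (inner ℝ (D u v) w : ℝ) = -inner ℝ v (D u w))
    (η_N : ∀ u, η (N u) = 0)
    (closed : ∀ u v, (inner ℝ (N u) v : ℝ) = inner ℝ (N v) u)
    (D_ξ : ∀ u, D u ξ = -φ (N u))
    (D_φ : ∀ u v, D u (φ v) + φ (D u v) = (inner ℝ (N u) v : ℝ) • ξ + η v • N u)
    (normal : ∀ u v, D (φ u) v - D (φ v) u + φ (D v u) - φ (D u v) = 0)
    (cyclic : ∀ u v w, (inner ℝ (D u v) w : ℝ) + inner ℝ (D v w) u + inner ℝ (D w u) v =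
      2 * α * (η u * inner ℝ (φ v) w + η v * inner ℝ (φ w) u + η w * inner ℝ (φ u) v)) :
    (∀ u, N u = α • (u - η u • ξ)) ∧
      ∀ u v, D u v = α • ((inner ℝ (φ u) v : ℝ) • ξ - η v • φ u) := by
  have inner_ξ' (v : V) : (inner ℝ ξ v : ℝ) = η v := by rw [real_inner_comm, inner_ξ]
  have N_ξ : N ξ = 0 := ext_inner_right ℝ fun w ↦ by
    rw [closed, inner_ξ, η_N, inner_zero_left]
  have η_D_ξ (u : V) : η (D ξ u) = 0 := by
    rw [← inner_ξ, skew, D_ξ, N_ξ, map_zero, neg_zero, inner_zero_right, neg_zero]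
  -- Normality for the pair `(u, ξ)`, after applying `φ`.
  have h1 (u w : V) : (inner ℝ (D ξ u) w : ℝ) = inner ℝ (N (φ u)) w - inner ℝ (φ (N u)) w := by
    have h := congrArg (fun t ↦ (inner ℝ t (φ w) : ℝ)) (normal u ξ)
    simp only [D_ξ, φ_ξ, D_zero, map_neg, sub_zero, sub_neg_eq_add, inner_add_left,
      inner_neg_left, inner_φ_φ, η_N, η_D_ξ, η_φ, inner_zero_left, zero_mul] at h
    linarith
  -- The right-hand side of `h1` is symmetric and the left-hand side is skew.
  have h2 (u w : V) : (inner ℝ (D ξ u) w : ℝ) = 0 := by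
    have e1 := h1 u w
    have e2 := h1 w u
    have e3 := skew ξ u w
    have e4 := closed (φ u) w
    have e5 := closed (φ w) u
    have e6 := inner_φ_right (N u) w
    have e7 := inner_φ_right (N w) u
    have e8 := real_inner_comm u (D ξ w)
    linarith
  have h3 (u w : V) : (inner ℝ (N u) (φ w) : ℝ) = α * inner ℝ u (φ w) := by
    have e0 := cyclic ξ u w
    have e1 := h1 u w
    have e2 := h1 w u
    have e3 := h2 u w
    have e4 := h2 w u
    have e5 := skew u w ξ
    have e7 := inner_φ_right (N u) w
    have e8 := inner_φ_right (N w) u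
    have e9 := inner_φ_right u w
    have e11 := real_inner_comm w (φ (N u))
    have e12 := closed (φ w) u
    have e10 := closed (φ u) w
    rw [D_ξ, inner_neg_right] at e5
    rw [D_ξ, inner_neg_left, φ_ξ, inner_zero_left, η_ξ, inner_ξ (φ w), η_φ] at e0
    rw [e9]
    linarith
  have hN (u : V) : N u = α • (u - η u • ξ) := by
    refine ext_inner_right ℝ fun w ↦ ?_
    have hw : w = η w • ξ - φ (φ w) := by rw [φ_φ]; abel
    have e := h3 u (φ w)
    have e' := inner_φ_right u (φ w)
    rw [inner_φ_φ] at e'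
    rw [hw, inner_sub_right, e, e', real_inner_smul_right, inner_ξ, η_N, ← hw,
      real_inner_smul_left, inner_sub_left, real_inner_smul_left, inner_ξ']
    ring
  refine ⟨hN, fun u v ↦ ?_⟩
  -- `Q` is the difference of both sides; it satisfies the same identities with `α = 0`.
  let Q (u v : V) : V := D u v - α • ((inner ℝ (φ u) v : ℝ) • ξ - η v • φ u)
  have φ_skew (u v : V) : (inner ℝ (φ u) v : ℝ) = -inner ℝ (φ v) u := by
    rw [real_inner_comm, inner_φ_right]
  have Q_skew (u v w : V) : (inner ℝ (Q u v) w : ℝ) = -inner ℝ v (Q u w) := by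
    simp only [Q, inner_sub_left, inner_sub_right, real_inner_smul_left, real_inner_smul_right,
      skew u v w, inner_ξ, inner_ξ', real_inner_comm (φ u) v]
    ring
  have η_Q (u v : V) : η (Q u v) = 0 := by
    rw [← inner_ξ, Q_skew]
    simp only [Q, D_ξ, hN, map_smul, map_sub, φ_ξ, inner_ξ, η_φ, η_ξ]
    simp
  have Q_φ (u v : V) : Q u (φ v) = -φ (Q u v) := by
    have h := D_φ u v
    simp only [Q, hN, map_smul, map_sub, φ_ξ, η_φ, φ_φ, inner_φ_φ, inner_smul_left,
      inner_sub_left, inner_ξ', conj_trivial] at h ⊢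
    linear_combination (norm := module) h
  have Q_normal (u v : V) : Q (φ u) v - Q (φ v) u + φ (Q v u) - φ (Q u v) = 0 := by
    have h := normal u v
    simp only [Q, map_smul, map_sub, φ_ξ, φ_φ, inner_add_left, inner_neg_left, inner_smul_left,
      inner_ξ', conj_trivial, real_inner_comm u v] at h ⊢
    linear_combination (norm := module) h
  have Q_cyclic (u v w : V) :
      (inner ℝ (Q u v) w : ℝ) + inner ℝ (Q v w) u + inner ℝ (Q w u) v = 0 := by
    have h := cyclic u v w
    simp only [Q, inner_sub_left, real_inner_smul_left, inner_ξ']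
    linear_combination h + α * (η u * φ_skew v w + η v * φ_skew w u + η w * φ_skew u v)
  have inner_φ_Q (u v w : V) : (inner ℝ (φ (Q u v)) (φ w) : ℝ) = inner ℝ (Q u v) w := by
    rw [inner_φ_φ, η_Q, zero_mul, sub_zero]
  have hQ : Q u v = 0 := by
    refine ext_inner_right ℝ fun w ↦ ?_
    have c1 := Q_cyclic u v w
    have c2 := Q_cyclic u (φ v) (φ w)
    have n := congrArg (fun t ↦ (inner ℝ t (φ u) : ℝ)) (Q_normal v w)
    simp only [inner_add_left, inner_sub_left, inner_zero_left, inner_φ_Q] at n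
    have a1 : (inner ℝ (Q u (φ v)) (φ w) : ℝ) = -inner ℝ (Q u v) w := by
      rw [Q_φ, inner_neg_left, inner_φ_Q]
    have a2 : (inner ℝ (Q (φ v) (φ w)) u : ℝ) = inner ℝ (Q (φ v) w) (φ u) := by
      rw [Q_φ, inner_neg_left, inner_φ_right]
    have a3 : (inner ℝ (Q (φ w) u) (φ v) : ℝ) = -inner ℝ (Q (φ w) v) (φ u) := by
      rw [Q_skew, Q_φ, inner_neg_right, inner_φ_right, neg_neg, real_inner_comm]
    have a4 := Q_skew w u v
    rw [real_inner_comm (Q w v) u] at a4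
    rw [inner_zero_left]
    linarith
  exact sub_eq_zero.1 hQ

end LinearAlgebra

/-! ### Covariant derivatives of the structure tensors -/

namespace AlmostContactMetric

open VectorField

variable {E : Type*} [NormedAddCommGroup E] [NormedSpace ℝ E]
  {M : Type*} [TopologicalSpace M] [ChartedSpace E M] [IsManifold 𝓘(ℝ, E) ∞ M]
  [RiemannianBundle (fun x : M ↦ TangentSpace 𝓘(ℝ, E) x)]
  (A : AlmostContactMetric E M)
  {lc qs : CovariantDerivative 𝓘(ℝ, E) E (TangentSpace 𝓘(ℝ, E) : M → Type _)}
  {X Y Z W : Π x : M, TangentSpace 𝓘(ℝ, E) x} {α : ℝ}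

lemma smoothField_ξ : SmoothField A.ξ := A.smooth_ξ

lemma smoothField_φ (hZ : SmoothField Z) : SmoothField (fun y ↦ A.φ y (Z y)) :=
  hZ.clm_apply A.smooth_φ

/-- `φ` does not vanish in dimension greater than one. -/
lemma exists_φ_ne_zero (hn : 1 < Module.finrank ℝ E) (x : M) :
    ∃ u, A.φ x u ≠ 0 := by
  by_contra! h
  refine hn.not_ge (finrank_le_one (R := ℝ) (M := TangentSpace 𝓘(ℝ, E) x) (A.ξ x) fun u ↦
    ⟨A.η x u, ?_⟩)
  have := A.φ_φ x u
  rw [h, neg_add_eq_sub] at this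
  exact (sub_eq_zero.1 this.symm)

variable [IsContMDiffRiemannianBundle 𝓘(ℝ, E) ∞ E (fun x : M ↦ TangentSpace 𝓘(ℝ, E) x)]

lemma contMDiff_η (hZ : SmoothField Z) : CMDiff ∞ (fun y ↦ A.η y (Z y)) := by
  simp only [← A.inner_ξ]
  exact hZ.inner A.smoothField_ξ

variable [FiniteDimensional ℝ E]

lemma mvfderiv_inner (hlc : IsLeviCivita lc) (hZ : SmoothField Z) (hW : SmoothField W) (x : M)
    (u : TangentSpace 𝓘(ℝ, E) x) :
    mvfderiv 𝓘(ℝ, E) (fun y ↦ (inner ℝ (Z y) (W y) : ℝ)) x u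
      = inner ℝ (lc Z x u) (W x) + inner ℝ (Z x) (lc W x u) := by
  have h := hlc.metric.mvfderiv_inner_eq (FiberBundle.extend E u) (hZ.mdiffAt x) (hW.mdiffAt x)
  simpa using h

lemma mlieBracket_eq (hlc : IsLeviCivita lc) (hX : SmoothField X) (hY : SmoothField Y) (x : M) :
    mlieBracket 𝓘(ℝ, E) X Y x = lc Y x (X x) - lc X x (Y x) :=
  ((lc.torsion_eq_zero_iff.1 hlc.torsion_free) (hX.mdiffAt x) (hY.mdiffAt x)).symm

lemma lieDerivMetric_ξ (hlc : IsLeviCivita lc) (hY : SmoothField Y) (hZ : SmoothField Z) (x : M) :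
    lieDerivMetric A.ξ Y Z x = lieDerivMetricWrt lc A.ξ x (Y x) (Z x) := by
  simp only [lieDerivMetric, lieDerivMetricWrt]
  rw [mvfderiv_inner hlc hY hZ, mlieBracket_eq hlc A.smoothField_ξ hY,
    mlieBracket_eq hlc A.smoothField_ξ hZ, inner_sub_left, inner_sub_right]
  ring

lemma dη_eq (hlc : IsLeviCivita lc) (hX : SmoothField X) (hY : SmoothField Y) (x : M) :
    A.dη X Y x = inner ℝ (lc A.ξ x (X x)) (Y x) - inner ℝ (lc A.ξ x (Y x)) (X x) := by
  have h (V P : Π x : M, TangentSpace 𝓘(ℝ, E) x) (hP : SmoothField P) :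
      mvfderiv 𝓘(ℝ, E) (fun y ↦ A.η y (P y)) x (V x) =
        A.η x (lc P x (V x)) + inner ℝ (lc A.ξ x (V x)) (P x) := by
    simp only [← A.inner_ξ]
    rw [mvfderiv_inner hlc hP A.smoothField_ξ, real_inner_comm (P x)]
  rw [dη, h _ _ hY, h _ _ hX, mlieBracket_eq hlc hX hY, map_sub]
  ring

lemma inner_cov_φ_sub (hlc : IsLeviCivita lc) (hZ : SmoothField Z) (hW : SmoothField W) (x : M)
    (u : TangentSpace 𝓘(ℝ, E) x) :
    (inner ℝ (lc (fun y ↦ A.φ y (Z y)) x u - A.φ x (lc Z x u)) (W x) : ℝ)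
      = -inner ℝ (Z x) (lc (fun y ↦ A.φ y (W y)) x u - A.φ x (lc W x u)) := by
  have h1 := mvfderiv_inner hlc (A.smoothField_φ hZ) hW x u
  have h2 := mvfderiv_inner hlc hZ (A.smoothField_φ hW) x u
  have h3 : (fun y ↦ (inner ℝ (Z y) (A.φ y (W y)) : ℝ)) =
      -(fun y ↦ inner ℝ (A.φ y (Z y)) (W y)) := by
    ext1 y
    exact A.inner_φ_right y _ _
  rw [h3, mvfderiv_neg, neg_apply, h1, A.inner_φ_right] at h2
  rw [inner_sub_left, inner_sub_right, A.inner_φ_right]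
  have h4 := A.inner_φ_right x (lc Z x u) (W x)
  linarith

variable [T2Space M]

variable (lc) in
/-- The tensor `(∇_u φ) v = ∇_u (φ v) - φ (∇_u v)`, computed with a smooth extension of `v`. -/
noncomputable def covDerivφ (x : M) (u v : TangentSpace 𝓘(ℝ, E) x) : TangentSpace 𝓘(ℝ, E) x :=
  lc (fun y ↦ A.φ y (smoothExt v y)) x u - A.φ x (lc (smoothExt v) x u)

/-- `∇φ` is a tensor: by skew-adjointness, it depends only on the value of the field. -/
lemma cov_φ (hlc : IsLeviCivita lc) (hZ : SmoothField Z) (x : M) (u : TangentSpace 𝓘(ℝ, E) x) :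
    lc (fun y ↦ A.φ y (Z y)) x u = A.φ x (lc Z x u) + A.covDerivφ lc x u (Z x) := by
  rw [← sub_eq_iff_eq_add']
  refine ext_inner_right ℝ fun w ↦ ?_
  have h1 := A.inner_cov_φ_sub hlc hZ (smoothField_smoothExt w) x u
  have h2 := A.inner_cov_φ_sub hlc (smoothField_smoothExt (Z x)) (smoothField_smoothExt w) x u
  rw [smoothExt_apply_self] at h1 h2
  rw [h1, covDerivφ, h2, smoothExt_apply_self]

lemma covDerivφ_skew (hlc : IsLeviCivita lc) (x : M) (u v w : TangentSpace 𝓘(ℝ, E) x) :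
    (inner ℝ (A.covDerivφ lc x u v) w : ℝ) = -inner ℝ v (A.covDerivφ lc x u w) := by
  have h := A.inner_cov_φ_sub hlc (smoothField_smoothExt v) (smoothField_smoothExt w) x u
  rwa [smoothExt_apply_self, smoothExt_apply_self] at h

lemma dΦ_eq_cyclic (hlc : IsLeviCivita lc) (hX : SmoothField X) (hY : SmoothField Y)
    (hZ : SmoothField Z) (x : M) :
    A.dΦ X Y Z x = inner ℝ (A.covDerivφ lc x (X x) (Y x)) (Z x)
      + inner ℝ (A.covDerivφ lc x (Y x) (Z x)) (X x)
      + inner ℝ (A.covDerivφ lc x (Z x) (X x)) (Y x) := by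
  have h (V : Π x : M, TangentSpace 𝓘(ℝ, E) x) {P Q : Π x : M, TangentSpace 𝓘(ℝ, E) x}
      (hP : SmoothField P) (hQ : SmoothField Q) :
      mvfderiv 𝓘(ℝ, E) (fun y ↦ A.Φ y (P y) (Q y)) x (V x) =
        inner ℝ (A.covDerivφ lc x (V x) (P x)) (Q x) + inner ℝ (A.φ x (lc P x (V x))) (Q x)
          - inner ℝ (A.φ x (lc Q x (V x))) (P x) := by
    simp only [Φ]
    have e := A.inner_φ_right x (lc Q x (V x)) (P x)
    rw [real_inner_comm] at e
    rw [mvfderiv_inner hlc (A.smoothField_φ hP) hQ, A.cov_φ hlc hP, inner_add_left, e]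
    ring
  rw [dΦ, h _ hY hZ, h _ hZ hX, h _ hX hY]
  simp only [Φ, mlieBracket_eq hlc, hX, hY, hZ, map_sub, inner_sub_left]
  ring

lemma nijenhuis_eq (hlc : IsLeviCivita lc) (hX : SmoothField X) (hY : SmoothField Y) (x : M) :
    A.nijenhuis X Y x = A.covDerivφ lc x (A.φ x (X x)) (Y x)
      - A.covDerivφ lc x (A.φ x (Y x)) (X x) + A.φ x (A.covDerivφ lc x (Y x) (X x))
      - A.φ x (A.covDerivφ lc x (X x) (Y x)) + A.dη X Y x • A.ξ x := by
  rw [nijenhuis, mlieBracket_eq hlc (A.smoothField_φ hX) (A.smoothField_φ hY),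
    mlieBracket_eq hlc (A.smoothField_φ hX) hY, mlieBracket_eq hlc hX (A.smoothField_φ hY),
    mlieBracket_eq hlc hX hY]
  simp only [A.cov_φ hlc hX, A.cov_φ hlc hY, map_sub, map_add]
  abel

/-- On an `α`-cosymplectic manifold, `∇_u ξ = α (u - η(u) ξ)` and
`(∇_u φ) v = α (g(φ u, v) ξ - η(v) φ u)`. -/
theorem IsAlphaCosymplectic.structure_equations {A : AlmostContactMetric E M}
    (hα : A.IsAlphaCosymplectic α) (hlc : IsLeviCivita lc) (x : M) :
    (∀ u, lc A.ξ x u = α • (u - A.η x u • A.ξ x)) ∧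
      ∀ u v, A.covDerivφ lc x u v =
        α • ((inner ℝ (A.φ x u) v : ℝ) • A.ξ x - A.η x v • A.φ x u) := by
  have sm {y : M} (v : TangentSpace 𝓘(ℝ, E) y) := smoothField_smoothExt v
  have hη (u v : TangentSpace 𝓘(ℝ, E) x) : A.dη (smoothExt u) (smoothExt v) x = 0 :=
    hα.closed_η x _ _ ((sm u).mdiffAt x) ((sm v).mdiffAt x)
  have η_cov (u : TangentSpace 𝓘(ℝ, E) x) : A.η x (lc A.ξ x u) = 0 := by
    have h := mvfderiv_inner hlc A.smoothField_ξ A.smoothField_ξ x u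
    simp only [A.inner_ξ, A.η_ξ, mvfderiv_const, zero_apply] at h
    rw [real_inner_comm, A.inner_ξ] at h
    linarith
  refine StarRicciYamabe.structure_equations (A.φ_φ x) (A.η_ξ x) (A.η_φ x) (A.φ_ξ x)
    (A.inner_φ_φ x) (A.inner_φ_right x) (A.inner_ξ x) ?_ (A.covDerivφ_skew hlc x) η_cov ?_ ?_ ?_
    ?_ ?_
  · intro v
    simp [covDerivφ]
  · intro u v
    have h := hη u v
    rw [A.dη_eq hlc (sm u) (sm v), smoothExt_apply_self, smoothExt_apply_self] at h
    linarith
  · intro u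
    have h := A.cov_φ hlc A.smoothField_ξ x u
    have h0 : (fun y ↦ A.φ y (A.ξ y)) = 0 := by
      ext1 y
      exact A.φ_ξ y
    rw [h0, lc.zero] at h
    exact (neg_eq_of_add_eq_zero_right h.symm).symm
  · intro u v
    have h1 := A.cov_φ hlc (A.smoothField_φ (sm v)) x u
    have h2 : (fun y ↦ A.φ y (A.φ y (smoothExt v y))) =
        (-1 : ℝ) • smoothExt v + (fun y ↦ A.η y (smoothExt v y)) • A.ξ := by
      ext1 y
      simp [A.φ_φ]
    have h3 : mvfderiv 𝓘(ℝ, E) (fun y ↦ A.η y (smoothExt v y)) x u =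
        A.η x (lc (smoothExt v) x u) + inner ℝ (lc A.ξ x u) v := by
      have h := mvfderiv_inner hlc (sm v) A.smoothField_ξ x u
      simp only [A.inner_ξ, smoothExt_apply_self] at h
      rw [h, real_inner_comm v]
    rw [h2, cov_add ((sm v).const_smul _) (A.smoothField_ξ.smul (A.contMDiff_η (sm v))),
      cov_const_smul _ (sm v), add_apply, cov_smul (A.contMDiff_η (sm v)) A.smoothField_ξ, h3,
      A.cov_φ hlc (sm v)] at h1
    simp only [smul_apply, smoothExt_apply_self, map_add, A.φ_φ] at h1
    linear_combination (norm := module) -h1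
  · intro u v
    have h := hα.normal x _ _ ((sm u).mdiffAt x) ((sm v).mdiffAt x)
    rwa [A.nijenhuis_eq hlc (sm u) (sm v), hη, zero_smul, add_zero, smoothExt_apply_self,
      smoothExt_apply_self] at h
  · intro u v w
    have h := hα.dΦ_eq x _ _ _ ((sm u).mdiffAt x) ((sm v).mdiffAt x) ((sm w).mdiffAt x)
    rw [A.dΦ_eq_cyclic hlc (sm u) (sm v) (sm w)] at h
    simpa only [smoothExt_apply_self, wedge, Φ] using h

/-- The quarter-symmetric metric connection is `∇̃_u Z = ∇_u Z - η(u) φ Z`. -/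
theorem IsQuarterSymmetricMetric.cov_eq {A : AlmostContactMetric E M}
    (hqs : A.IsQuarterSymmetricMetric qs) (hlc : IsLeviCivita lc) (hZ : SmoothField Z) (x : M)
    (u : TangentSpace 𝓘(ℝ, E) x) : qs Z x u = lc Z x u - A.η x u • A.φ x (Z x) := by
  have hd {P : Π x : M, TangentSpace 𝓘(ℝ, E) x} (hP : SmoothField P)
      (u : TangentSpace 𝓘(ℝ, E) x) : qs.difference lc x (P x) u = qs P x u - lc P x u := by
    have := IsCovariantDerivativeOn.difference_apply qs.isCovariantDerivativeOnUniv
      lc.isCovariantDerivativeOnUniv (x := x) (hx := trivial) (hP.mdiffAt x)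
    exact congrArg (fun f ↦ f u) this
  have sm {y : M} (v : TangentSpace 𝓘(ℝ, E) y) := smoothField_smoothExt v
  have hB : qs.difference lc x (Z x) u + A.η x u • A.φ x (Z x) = 0 := by
    refine eq_zero_of_symm_of_skew
      (B := fun v u ↦ qs.difference lc x v u + A.η x u • A.φ x v) ?_ ?_ u (Z x)
    · intro u v
      have h := hqs.torsion_eq x u v
      have h1 := qs.torsion_apply ((sm u).mdiffAt x) ((sm v).mdiffAt x)
      have h2 := mlieBracket_eq hlc (sm u) (sm v) x
      have h3 := hd (sm u) v
      have h4 := hd (sm v) u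
      simp only [smoothExt_apply_self] at h1 h2 h3 h4
      rw [h3, h4]
      rw [h1, h2] at h
      linear_combination (norm := module) -h
    · intro u v w
      have h1 := mvfderiv_inner hlc (sm v) (sm w) x u
      have h2 := hqs.metric.mvfderiv_inner_eq (smoothExt u) ((sm v).mdiffAt x)
        ((sm w).mdiffAt x)
      have h3 := hd (sm v) u
      have h4 := hd (sm w) u
      simp only [smoothExt_apply_self] at h1 h2 h3 h4
      simp only [inner_add_left, inner_add_right, real_inner_smul_left, real_inner_smul_right, h3,
        h4, inner_sub_left, inner_sub_right, A.inner_φ_right]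
      linarith
  rw [hd hZ] at hB
  linear_combination (norm := module) hB

/-- The curvature of the quarter-symmetric metric connection when `dη = 0`. -/
theorem IsQuarterSymmetricMetric.curvatureField_eq {A : AlmostContactMetric E M}
    (hqs : A.IsQuarterSymmetricMetric qs) (hlc : IsLeviCivita lc) (hη : A.IsClosedη)
    (hX : SmoothField X) (hY : SmoothField Y) (hZ : SmoothField Z) (x : M) :
    curvatureField qs X Y Z x = curvatureField lc X Y Z x
      - A.η x (Y x) • A.covDerivφ lc x (X x) (Z x)
      + A.η x (X x) • A.covDerivφ lc x (Y x) (Z x) := by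
  have h1 {V : Π x : M, TangentSpace 𝓘(ℝ, E) x} (hV : SmoothField V)
      (u : TangentSpace 𝓘(ℝ, E) x) : qs (fun y ↦ qs Z y (V y)) x u =
      lc (fun y ↦ lc Z y (V y)) x u - A.η x (V x) • (A.φ x (lc Z x u) + A.covDerivφ lc x u (Z x))
        - mvfderiv 𝓘(ℝ, E) (fun y ↦ A.η y (V y)) x u • A.φ x (Z x)
        - A.η x u • A.φ x (lc Z x (V x) - A.η x (V x) • A.φ x (Z x)) := by
    have hφZ := A.smoothField_φ hZ
    have e : (fun y ↦ qs Z y (V y)) = (fun y ↦ lc Z y (V y))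
        + (-1 : ℝ) • ((fun y ↦ A.η y (V y)) • fun y ↦ A.φ y (Z y)) := by
      ext1 y
      simp [hqs.cov_eq hlc hZ, sub_eq_add_neg]
    have s1 := hφZ.smul (A.contMDiff_η hV)
    rw [hqs.cov_eq hlc (hV.cov hqs.smooth hZ), e,
      cov_add (hV.cov hlc.smooth hZ) (s1.const_smul _), add_apply, cov_const_smul _ s1, smul_apply,
      cov_smul (A.contMDiff_η hV) hφZ, A.cov_φ hlc hZ]
    simp only [hqs.cov_eq hlc hZ, map_sub, map_smul]
    module
  have h2 := hη x X Y (hX.mdiffAt x) (hY.mdiffAt x)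
  rw [dη] at h2
  simp only [curvatureField]
  rw [h1 hX, h1 hY, hqs.cov_eq hlc hZ]
  simp only [map_sub, map_smul]
  linear_combination (norm := module) -h2 • A.φ x (Z x)

end AlmostContactMetric

/-! ### Ricci tensors and solitons -/

namespace AlmostContactMetric

variable {E : Type*} [NormedAddCommGroup E] [NormedSpace ℝ E] [FiniteDimensional ℝ E]
  {M : Type*} [TopologicalSpace M] [ChartedSpace E M] [IsManifold 𝓘(ℝ, E) ∞ M]
  [RiemannianBundle (fun x : M ↦ TangentSpace 𝓘(ℝ, E) x)]

lemma sum_η_mul_inner_frame (A : AlmostContactMetric E M) (x : M) (v : TangentSpace 𝓘(ℝ, E) x) :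
    ∑ i, A.η x (frame x i) * (inner ℝ (frame x i) v : ℝ) = A.η x v := by
  rw [← A.inner_ξ x v, real_inner_comm, ← (frame x).sum_inner_mul_inner]
  simp only [← A.inner_ξ, real_inner_comm]

lemma metricTrace_comp_φ (A : AlmostContactMetric E M) (x : M)
    (B : TangentSpace 𝓘(ℝ, E) x →ₗ[ℝ] TangentSpace 𝓘(ℝ, E) x →ₗ[ℝ] ℝ) :
    metricTrace x (fun u v ↦ B (A.φ x u) (A.φ x v)) =
      metricTrace x (fun u v ↦ B u v) - B (A.ξ x) (A.ξ x) := by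
  -- `φ` is skew-adjoint, so it may be moved to the second argument under the trace.
  have h1 : ∑ i, B (A.φ x (frame x i)) (A.φ x (frame x i)) =
      -∑ j, B (frame x j) (A.φ x (A.φ x (frame x j))) := by
    have e (i) : B (A.φ x (frame x i)) (A.φ x (frame x i)) =
        ∑ j, (inner ℝ (frame x j) (A.φ x (frame x i)) : ℝ)
          * B (frame x j) (A.φ x (frame x i)) := by
      conv_lhs => enter [1]; rw [← (frame x).sum_repr' (A.φ x (frame x i))]
      simp [LinearMap.sum_apply]
    have e' (j) : A.φ x (A.φ x (frame x j)) =
        -∑ i, (inner ℝ (frame x j) (A.φ x (frame x i)) : ℝ) • A.φ x (frame x i) := by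
      conv_lhs => rw [← (frame x).sum_repr' (A.φ x (frame x j))]
      simp only [map_sum, map_smul, ← Finset.sum_neg_distrib, ← neg_smul]
      refine Finset.sum_congr rfl fun i _ ↦ ?_
      rw [A.inner_φ_right x (frame x j), neg_neg, real_inner_comm]
    simp only [e, e', map_neg, map_sum, map_smul, smul_eq_mul, Finset.sum_neg_distrib, neg_neg]
    rw [Finset.sum_comm]
  have h2 : ∑ j, A.η x (frame x j) * B (frame x j) (A.ξ x) = B (A.ξ x) (A.ξ x) := by
    conv_rhs => enter [1]; rw [← (frame x).sum_repr' (A.ξ x)]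
    simp [LinearMap.sum_apply, A.inner_ξ]
  simp only [metricTrace]
  rw [h1, ← h2, ← Finset.sum_neg_distrib, ← Finset.sum_sub_distrib]
  refine Finset.sum_congr rfl fun j _ ↦ ?_
  rw [A.φ_φ, map_add, map_neg, map_smul, smul_eq_mul]
  ring

/-- `η ∧ Φ` does not vanish, since its value on `ξ, u, φ u` is `|φ u|²`. -/
lemma IsAlphaCosymplectic.isCosymplectic_iff [T2Space M] {A : AlmostContactMetric E M} {α : ℝ}
    (hα : A.IsAlphaCosymplectic α) (hn : 1 < Module.finrank ℝ E) [Nonempty M] :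
    A.IsCosymplectic ↔ α = 0 := by
  refine ⟨fun h ↦ ?_, fun h ↦ ⟨hα.normal, hα.closed_η, fun x X Y Z hX hY hZ ↦ ?_⟩⟩
  · obtain ⟨x⟩ := ‹Nonempty M›
    obtain ⟨u, hu⟩ := A.exists_φ_ne_zero hn x
    have hd {y : M} (v : TangentSpace 𝓘(ℝ, E) y) := (smoothField_smoothExt v).mdiffAt y
    have h1 := hα.dΦ_eq x _ _ _ (hd (A.ξ x)) (hd u) (hd (A.φ x u))
    rw [h.closed_Φ x _ _ _ (hd (A.ξ x)) (hd u) (hd (A.φ x u))] at h1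
    simp only [smoothExt_apply_self, wedge, Φ, A.η_ξ, A.η_φ, A.φ_ξ, A.inner_ξ, inner_zero_left]
      at h1
    have h2 : (inner ℝ (A.φ x u) (A.φ x u) : ℝ) ≠ 0 := inner_self_ne_zero.2 hu
    have h3 : α * (inner ℝ (A.φ x u) (A.φ x u) : ℝ) = 0 := by linarith
    exact (mul_eq_zero.1 h3).resolve_right h2
  · rw [hα.dΦ_eq x X Y Z hX hY hZ, h]
    ring

variable [IsContMDiffRiemannianBundle 𝓘(ℝ, E) ∞ E (fun x : M ↦ TangentSpace 𝓘(ℝ, E) x)]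
  [T2Space M] {A : AlmostContactMetric E M}
  {lc qs : CovariantDerivative 𝓘(ℝ, E) E (TangentSpace 𝓘(ℝ, E) : M → Type _)} {α : ℝ}

/-- `R̃(u, v) w` on an `α`-cosymplectic manifold. -/
lemma IsQuarterSymmetricMetric.curvature_eq (hqs : A.IsQuarterSymmetricMetric qs)
    (hlc : IsLeviCivita lc) (hα : A.IsAlphaCosymplectic α) (x : M)
    (u v w : TangentSpace 𝓘(ℝ, E) x) :
    curvature qs x u v w = curvature lc x u v w
      - (α * A.η x v) • ((inner ℝ (A.φ x u) w : ℝ) • A.ξ x - A.η x w • A.φ x u)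
      + (α * A.η x u) • ((inner ℝ (A.φ x v) w : ℝ) • A.ξ x - A.η x w • A.φ x v) := by
  rw [curvature_eq_smoothExt hqs.smooth, hqs.curvatureField_eq hlc hα.closed_η
    (smoothField_smoothExt u) (smoothField_smoothExt v) (smoothField_smoothExt w),
    ← curvature_eq_smoothExt hlc.smooth]
  simp only [smoothExt_apply_self, (hα.structure_equations hlc x).2, smul_smul,
    mul_comm _ α]

/-- The Ricci tensors of the two connections differ by `α Φ`, which is skew. -/
lemma IsQuarterSymmetricMetric.ricci_eq (hqs : A.IsQuarterSymmetricMetric qs)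
    (hlc : IsLeviCivita lc) (hα : A.IsAlphaCosymplectic α) (x : M)
    (v w : TangentSpace 𝓘(ℝ, E) x) :
    ricci qs x v w = ricci lc x v w + α * A.Φ x v w := by
  have inner_ξ' (z : TangentSpace 𝓘(ℝ, E) x) : (inner ℝ (A.ξ x) z : ℝ) = A.η x z := by
    rw [real_inner_comm, A.inner_ξ]
  have h1 := A.sum_η_mul_inner_frame x (A.φ x w)
  have h2 := A.sum_η_mul_inner_frame x (A.φ x v)
  have h3 := A.sum_η_mul_inner_frame x (A.ξ x)
  simp only [A.inner_ξ, A.η_ξ, A.η_φ] at h1 h2 h3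
  have e (u : TangentSpace 𝓘(ℝ, E) x) : (inner ℝ (curvature qs x u v w) u : ℝ) =
      inner ℝ (curvature lc x u v w) u + α * A.η x v * (A.η x u * inner ℝ u (A.φ x w))
        + α * A.Φ x v w * (A.η x u * A.η x u)
        - α * A.η x w * (A.η x u * inner ℝ u (A.φ x v)) := by
    have hs : (inner ℝ (A.φ x u) u : ℝ) = 0 := by
      have := A.inner_φ_right x u u
      rw [real_inner_comm] at this
      linarith
    simp only [hqs.curvature_eq hlc hα, inner_add_left, inner_sub_left, real_inner_smul_left,
      inner_ξ', hs, Φ, A.inner_φ_right x u w, real_inner_comm u (A.φ x v)]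
    ring
  simp only [ricci, metricTrace, e, Finset.sum_add_distrib, Finset.sum_sub_distrib,
    ← Finset.mul_sum, h1, h2, h3]
  ring

/-- If `∇φ = 0`, then `R(u, v)` commutes with `φ`. -/
lemma curvature_φ (hlc : IsLeviCivita lc) (hφ : ∀ x u v, A.covDerivφ lc x u v = 0) (x : M)
    (u v w : TangentSpace 𝓘(ℝ, E) x) :
    curvature lc x u v (A.φ x w) = A.φ x (curvature lc x u v w) := by
  have hU := smoothField_smoothExt u
  have hV := smoothField_smoothExt v
  have hW := smoothField_smoothExt w
  have h {Z : Π x : M, TangentSpace 𝓘(ℝ, E) x} (hZ : SmoothField Z) (y : M)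
      (t : TangentSpace 𝓘(ℝ, E) y) : lc (fun z ↦ A.φ z (Z z)) y t = A.φ y (lc Z y t) := by
    rw [A.cov_φ hlc hZ, hφ, add_zero]
  have e := curvature_apply hlc hU hV (A.smoothField_φ hW) x
  simp only [smoothExt_apply_self] at e
  rw [e, curvature_eq_smoothExt hlc.smooth]
  simp only [curvatureField, h hW]
  rw [h (hV.cov hlc.smooth hW), h (hU.cov hlc.smooth hW), map_sub, map_sub]

/-- If `∇φ = 0`, as on a cosymplectic manifold, the `*`-Ricci tensor is the Ricci tensor. -/
lemma starRicci_eq_ricci (hlc : IsLeviCivita lc) (hφ : ∀ x u v, A.covDerivφ lc x u v = 0) (x : M)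
    (u v : TangentSpace 𝓘(ℝ, E) x) : A.starRicci lc x u v = ricci lc x u v := by
  have hξ (a b : TangentSpace 𝓘(ℝ, E) x) : curvature lc x a b (A.ξ x) = 0 := by
    have h1 := A.φ_φ x (curvature lc x a b (A.ξ x))
    have h0 := curvature_smul_third a b (0 : TangentSpace 𝓘(ℝ, E) x) hlc 0
    have h2 := inner_curvature_skew a b (A.ξ x) (A.ξ x) hlc
    have h3 : A.η x (curvature lc x a b (A.ξ x)) = 0 := by
      rw [A.inner_ξ] at h2
      linarith
    rw [zero_smul, zero_smul] at h0
    rw [← curvature_φ hlc hφ, A.φ_ξ, h0, map_zero, h3, zero_smul, add_zero] at h1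
    exact neg_eq_zero.1 h1.symm
  have hη (a b c : TangentSpace 𝓘(ℝ, E) x) : A.η x (curvature lc x a b c) = 0 := by
    rw [← A.inner_ξ, inner_curvature_skew _ _ _ _ hlc, hξ, inner_zero_left, neg_zero]
  -- The first Bianchi identity splits `g(R(u, φv) φw, w)` into two terms: the one with `R(φv, φw)`
  -- has trace `S(u, v)`, and so has the other one, up to a term in `ξ`, which vanishes.
  have e (w : TangentSpace 𝓘(ℝ, E) x) :
      (inner ℝ (curvature lc x u (A.φ x v) (A.φ x w)) w : ℝ) =
        curvatureForm u v hlc w w + curvatureForm u v hlc (A.φ x w) (A.φ x w) := by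
    have hb := congrArg (fun t ↦ (inner ℝ t w : ℝ)) (curvature_bianchi u (A.φ x v) (A.φ x w) hlc)
    simp only [inner_add_left, inner_zero_left] at hb
    have h1 : (inner ℝ (curvature lc x (A.φ x v) (A.φ x w) u) w : ℝ) =
        -inner ℝ (curvature lc x w u v) w := by
      rw [inner_curvature_pair_symm _ _ _ _ hlc, curvature_φ hlc hφ, A.inner_φ_φ, hη, zero_mul,
        sub_zero, curvature_swap _ _ _ hlc, inner_neg_left]
    have h2 : (inner ℝ (curvature lc x (A.φ x w) u (A.φ x v)) w : ℝ) =
        -inner ℝ (curvature lc x (A.φ x w) u v) (A.φ x w) := by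
      rw [curvature_φ hlc hφ, A.inner_φ_right, neg_neg]
    simp only [curvatureForm, LinearMap.mk₂_apply]
    linarith
  have ht := A.metricTrace_comp_φ x (curvatureForm u v hlc)
  have hξξ : curvatureForm u v hlc (A.ξ x) (A.ξ x) = 0 := by
    rw [curvatureForm, LinearMap.mk₂_apply, A.inner_ξ, hη]
  have hS : ricci lc x u v = metricTrace x (fun a b ↦ curvatureForm u v hlc a b) := rfl
  rw [hξξ, sub_zero, ← hS] at ht
  rw [starRicci]
  simp only [metricTrace, e, Finset.sum_add_distrib]
  simp only [metricTrace] at ht hS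
  rw [ht, ← hS]
  ring

/-- The skew part of the soliton equation for the quarter-symmetric metric connection is
`2ρα Φ = 0`. -/
lemma IsQuarterSoliton.alpha_eq_zero (hqs : A.IsQuarterSymmetricMetric qs) (hlc : IsLeviCivita lc)
    (hα : A.IsAlphaCosymplectic α) (hn : 1 < Module.finrank ℝ E) [Nonempty M] {ρ q Λ μ : ℝ}
    (hρ : ρ ≠ 0) (h : A.IsQuarterSoliton qs α ρ q Λ μ) : α = 0 := by
  obtain ⟨x⟩ := ‹Nonempty M›
  obtain ⟨u, hu⟩ := A.exists_φ_ne_zero hn x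
  have h1 := h x u (A.φ x u)
  have h2 := h x (A.φ x u) u
  have hL : lieDerivMetricWrt qs A.ξ x (A.φ x u) u = lieDerivMetricWrt qs A.ξ x u (A.φ x u) := by
    simp only [lieDerivMetricWrt]
    rw [real_inner_comm, real_inner_comm (qs A.ξ x u), add_comm]
  have hΦ : A.Φ x (A.φ x u) u = -A.Φ x u (A.φ x u) := by
    rw [Φ, Φ, real_inner_comm, A.inner_φ_right]
  rw [hqs.ricci_eq hlc hα] at h1 h2
  rw [hL, real_inner_comm, ricci_symm _ _ hlc, hΦ] at h2
  have h3 : ρ * (α * A.Φ x u (A.φ x u)) = 0 := by linarith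
  exact (mul_eq_zero.1 ((mul_eq_zero.1 h3).resolve_left hρ)).resolve_right (inner_self_ne_zero.2 hu)

/-- If `α = 0`, both soliton equations agree. -/
lemma IsSoliton.isQuarterSoliton (hqs : A.IsQuarterSymmetricMetric qs) (hlc : IsLeviCivita lc)
    (hα : A.IsAlphaCosymplectic 0) {ρ q Λ μ : ℝ} (h : A.IsSoliton lc ρ q Λ μ) :
    A.IsQuarterSoliton qs 0 ρ q Λ μ := by
  intro x u v
  have hφ (x : M) (u v : TangentSpace 𝓘(ℝ, E) x) : A.covDerivφ lc x u v = 0 := by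
    rw [(hα.structure_equations hlc x).2, zero_smul]
  have hS (u v : TangentSpace 𝓘(ℝ, E) x) : ricci qs x u v = A.starRicci lc x u v := by
    rw [hqs.ricci_eq hlc hα, starRicci_eq_ricci hlc hφ, zero_mul, add_zero]
  have hr : scalarCurvature qs x = A.starScalar lc x := by
    simp only [scalarCurvature, starScalar, metricTrace, hS]
  have hL : lieDerivMetricWrt qs A.ξ x u v = lieDerivMetricWrt lc A.ξ x u v := by
    simp only [lieDerivMetricWrt, hqs.cov_eq hlc A.smoothField_ξ, A.φ_ξ, smul_zero, sub_zero]
  have hu := smoothField_smoothExt u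
  have hv := smoothField_smoothExt v
  have h1 := h x _ _ (hu.mdiffAt x) (hv.mdiffAt x)
  rw [A.lieDerivMetric_ξ hlc hu hv, smoothExt_apply_self, smoothExt_apply_self] at h1
  rw [hL, hS, hr]
  linear_combination h1

end AlmostContactMetric

end StarRicciYamabe

theorem corollary4p2
    {E : Type*} [NormedAddCommGroup E] [NormedSpace ℝ E] [FiniteDimensional ℝ E]
    (hn : 2 < Module.finrank ℝ E)
    {M : Type*} [TopologicalSpace M] [T2Space M] [SecondCountableTopology M] [ConnectedSpace M]
    [ChartedSpace E M] [IsManifold 𝓘(ℝ, E) ∞ M]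
    [RiemannianBundle (fun x : M ↦ TangentSpace 𝓘(ℝ, E) x)]
    [IsContMDiffRiemannianBundle 𝓘(ℝ, E) ∞ E (fun x : M ↦ TangentSpace 𝓘(ℝ, E) x)]
    (A : StarRicciYamabe.AlmostContactMetric E M) (α : ℝ) (hα : A.IsAlphaCosymplectic α)
    (lc qs : CovariantDerivative 𝓘(ℝ, E) E (TangentSpace 𝓘(ℝ, E) : M → Type _))
    (hlc : StarRicciYamabe.IsLeviCivita lc) (hqs : A.IsQuarterSymmetricMetric qs)
    (ρ q Λ μ : ℝ) (hρ : ρ ≠ 0) (hsol : A.IsSoliton lc ρ q Λ μ) :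
    (A.IsQuarterSoliton qs α ρ q Λ μ ↔ A.IsCosymplectic) ∧
    ((∃ ρ' q' Λ' μ' : ℝ, ρ' ≠ 0 ∧ A.IsQuarterSoliton qs α ρ' q' Λ' μ') ↔ A.IsCosymplectic) ∧
    (A.IsCosymplectic ↔ α = 0) := by
  have hn' : 1 < Module.finrank ℝ E := by omega
  have hiff := hα.isCosymplectic_iff hn'
  have hto (h : A.IsCosymplectic) : A.IsQuarterSoliton qs α ρ q Λ μ := by
    obtain rfl := hiff.1 h
    exact hsol.isQuarterSoliton hqs hlc hα
  exact ⟨⟨fun h ↦ hiff.2 (h.alpha_eq_zero hqs hlc hα hn' hρ), hto⟩,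
    ⟨fun ⟨_, _, _, _, hρ', h⟩ ↦ hiff.2 (h.alpha_eq_zero hqs hlc hα hn' hρ'),
      fun h ↦ ⟨ρ, q, Λ, μ, hρ, hto h⟩⟩, hiff⟩
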